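/- Let $N$ agents have states $x_1,\dots,x_N\in\mathbb R^n$ (Euclidean norm $\|\cdot\|$), write $x=(x_1,\dots,x_N)\in\mathbb R^{nN}$, and let $a:[0,+\infty)\to[0,+\infty)$ be Lipschitz continuous, non-decreasing, and such that $a(r)>0$ for $r>0$. Consider $$\dot x_i=\sum_{j\in N_i(x)}a(\|x_j-x_i\|)\,(x_j-x_i),\qquad i=1,\dots,N.\qquad(*)$$ In the metric model, $N_i(x)=\{j:\|x_j-x_i\|<1\}$. In the topological model with $\kappa$ neighbors, $1\le\kappa\le N-1$, the set $N_i(x)$ consists of the first $\kappa$ agents in the list of all agents $j\ne i$ ordered by increasing $\|x_j-x_i\|$, ties being resolved in favor of the lower index. Write $(*)$ as $\dot x=g(x)$. A Caratheodory solution on $[0,T]$ is an absolutely continuous function $x:[0,T]\to\mathbb R^{nN}$ with $\dot x(t)=g(x(t))$ for a.e. $t\in[0,T]$. A Krasovsky solution on $[0,T]$ is an absolutely continuous function $x:[0,T]\to\mathbb R^{nN}$ with $\dot x(t)\in K(x(t))$ for a.e. $t\in[0,T]$, where $K(y)=\bigcap_{\delta>0}\overline{co}\{g(z):\|z-y\|<\delta\}$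 and $\overline{co}$ is the closed convex hull. A solution on $[0,+\infty)$ is a function whose restriction to $[0,T]$ is a solution for every $T>0$. Consider the following properties of a solution $x(\cdot)$. (P1) $\frac1N\sum_i x_i(t)=\frac1N\sum_i x_i(0)$ for all $t\ge0$ in the time interval of the solution. (P2) $\overline{co}\{x_1(T_2),\dots,x_N(T_2)\}\subseteq\overline{co}\{x_1(T_1),\dots,x_N(T_1)\}$ for all $0\le T_1\le T_2$ in the time interval of the solution. (P3) As $t\to+\infty$, $x(t)$ converges to a cluster point, i.e. to some $x^\infty\in\mathbb R^{nN}$ such that $x^\infty_i=x^\infty_j$ for every $i$ and every $j\in N_i(x^\infty)$. **Theorem (properties of solutions).** (i) All Caratheodory and all Krasovsky solutions of the metric model satisfy (P1) and (P2), both on $[0,T]$ for any $T>0$ and on $[0,+\infty)$, and those on $[0,+\infty)$ satisfy (P3). (ii) All Caratheodory and all Krasovsky solutions of the topological model satisfy (P2), both on $[0,T]$ for any $T>0$ and on $[0,+\infty)$. They may fail (P1) and (P3): for each of the two notions of solution and each of the properties (P1) and (P3) there are $n,N,\kappa,a$ as above and a solution on $[0,+\infty)$ of the topological model that does not have the property.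 (iii) If $\kappa=1$, all Caratheodory solutions on $[0,+\infty)$ of the topological model satisfy (P3). Even with $\kappa=1$, there are $n,N,a$ as above and a Caratheodory solution on $[0,+\infty)$ failing (P1), a Krasovsky solution on $[0,+\infty)$ failing (P1), and a Krasovsky solution on $[0,+\infty)$ failing (P3). -/

import Mathlib

open Set Filter Topology MeasureTheory
open scoped NNReal

/-! ### Generalized solutions of `ẋ = g(x)` with a possibly discontinuous `g` -/

section GeneralizedSolutions

variable {X : Type*} [NormedAddCommGroup X] [NormedSpace ℝ X]

/-- The closed convex hull: the closure of the convex hull. -/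
def closedHull (A : Set X) : Set X := closure (convexHull ℝ A)

/-- The Krasovsky multifunction of `g`: the intersection over `δ > 0` of the closed convex hulls
of the images of the balls `B(x, δ)`. In finite dimension it does not depend on the choice of
the norm. -/
def krasovsky (g : X → X) (x : X) : Set X :=
  ⋂ δ : ℝ, ⋂ _ : 0 < δ, closedHull (g '' Metric.ball x δ)

/-- Caratheodory solution of `ẋ = g(x)` on `[0, T]`. Only the values of `x` on `[0, T]` matter. -/
def IsCaratheodorySolution (g : X → X) (T : ℝ) (x : ℝ → X) : Prop :=
  AbsolutelyContinuousOnInterval x 0 T ∧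
    ∀ᵐ t ∂(volume.restrict (Icc 0 T)), HasDerivAt x (g (x t)) t

/-- Krasovsky solution of `ẋ = g(x)` on `[0, T]`: a solution of `ẋ ∈ K(x)`, where `K` is the
Krasovsky multifunction of `g`. Only the values of `x` on `[0, T]` matter. -/
def IsKrasovskySolution (g : X → X) (T : ℝ) (x : ℝ → X) : Prop :=
  AbsolutelyContinuousOnInterval x 0 T ∧
    ∀ᵐ t ∂(volume.restrict (Icc 0 T)), ∃ v ∈ krasovsky g (x t), HasDerivAt x v t

/-- Caratheodory solution on `[0, +∞)`. -/
def IsGlobalCaratheodorySolution (g : X → X) (x : ℝ → X) : Prop :=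
  ∀ T : ℝ, 0 < T → IsCaratheodorySolution g T x

/-- Krasovsky solution on `[0, +∞)`. -/
def IsGlobalKrasovskySolution (g : X → X) (x : ℝ → X) : Prop :=
  ∀ T : ℝ, 0 < T → IsKrasovskySolution g T x

end GeneralizedSolutions

/-! ### The bounded confidence models -/

/-- The states of `N` agents with opinions in `ℝⁿ` (Euclidean norm on each opinion). -/
abbrev State (n N : ℕ) : Type := Fin N → EuclideanSpace ℝ (Fin n)

/-- Standing assumptions on the interaction strength `a : [0, +∞) → [0, +∞)`. -/
structure IsInteractionFunction (a : ℝ≥0 → ℝ≥0) : Prop where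
  lipschitz : ∃ L : ℝ≥0, LipschitzWith L a
  pos : ∀ r : ℝ≥0, 0 < r → 0 < a r
  monotone : Monotone a

/-- The right-hand side `(∑_{j ∈ N_i(x)} a(‖x_j - x_i‖) (x_j - x_i))_i` for the rule
`nbr x i = N_i(x)` of choosing neighbors. -/
noncomputable def opinionField {n N : ℕ} (a : ℝ≥0 → ℝ≥0)
    (nbr : State n N → Fin N → Finset (Fin N)) (x : State n N) : State n N :=
  fun i => ∑ j ∈ nbr x i, (a ‖x j - x i‖₊ : ℝ) • (x j - x i)

open Classical in
/-- Metric neighbors: the agents at distance less than one. -/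
noncomputable def metricNeighbors {n N : ℕ} (x : State n N) (i : Fin N) : Finset (Fin N) :=
  Finset.univ.filter fun j => ‖x j - x i‖ < 1

/-- `k` comes before `j` in the list of agents ordered by increasing distance from `i`, where
ties are resolved in favor of the lower index. -/
def Precedes {n N : ℕ} (x : State n N) (i k j : Fin N) : Prop :=
  ‖x k - x i‖ < ‖x j - x i‖ ∨ (‖x k - x i‖ = ‖x j - x i‖ ∧ k < j)

open Classical in
/-- Topological neighbors: the first `κ` elements of the list of all agents other than `i`,
ordered by increasing distance from `i` with ties resolved by index; that is, the agents `j ≠ i`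
preceded in this list by fewer than `κ` others. -/
noncomputable def topologicalNeighbors {n N : ℕ} (κ : ℕ) (x : State n N) (i : Fin N) :
    Finset (Fin N) :=
  Finset.univ.filter fun j =>
    j ≠ i ∧ (Finset.univ.filter fun k => k ≠ i ∧ Precedes x i k j).card < κ

/-- The vector field of the metric bounded confidence model. -/
noncomputable def metricField {n N : ℕ} (a : ℝ≥0 → ℝ≥0) : State n N → State n N :=
  opinionField a metricNeighbors

/-- The vector field of the topological bounded confidence model with `κ` neighbors. -/
noncomputable def topologicalField {n N : ℕ} (κ : ℕ) (a : ℝ≥0 → ℝ≥0) : State n N → State n N :=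
  opinionField a (topologicalNeighbors κ)

/-! ### Properties of trajectories -/

/-- The average opinion. -/
noncomputable def average {n N : ℕ} (y : State n N) : EuclideanSpace ℝ (Fin n) :=
  (1 / (N : ℝ)) • ∑ i, y i

/-- (P1) The average is constant on the time set `I` (which is `[0, T]` or `[0, +∞)`). -/
def PreservesAverage {n N : ℕ} (I : Set ℝ) (x : ℝ → State n N) : Prop :=
  ∀ t ∈ I, average (x t) = average (x 0)

/-- (P2) Contractivity of the support on the time set `I`. -/
def ContractsSupport {n N : ℕ} (I : Set ℝ) (x : ℝ → State n N) : Prop :=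
  ∀ T₁ ∈ I, ∀ T₂ ∈ I, T₁ ≤ T₂ → closedHull (range (x T₂)) ⊆ closedHull (range (x T₁))

/-- Points in which every agent coincides with all of its neighbors. -/
def IsClusterPoint {n N : ℕ} (nbr : State n N → Fin N → Finset (Fin N)) (y : State n N) : Prop :=
  ∀ i, ∀ j ∈ nbr y i, y i = y j

/-- (P3) Convergence to a cluster point as `t → +∞`. -/
def ConvergesToClusterPoint {n N : ℕ} (nbr : State n N → Fin N → Finset (Fin N))
    (x : ℝ → State n N) : Prop :=
  ∃ y : State n N, IsClusterPoint nbr y ∧ Tendsto x atTop (𝓝 y)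

/-!
A Caratheodory solution is a Krasovsky solution, so all positive claims but the last one concern
Krasovsky solutions. A bound on a convex function of `g z`, valid for `z` near `x` and continuous
in `z`, passes to all velocities in `krasovsky g x` (`le_of_mem_krasovsky`); together with the
fundamental theorem of calculus for absolutely continuous functions this turns inequalities for the
vector field into inequalities along trajectories.

*Support.* For a linear functional `p`, the maximum of `p (x i)` over the agents does not increase:
an agent attaining it is attracted by agents with at most the same value of `p`. By the Hahn-Banach
theorem the closed convex hull of the agents shrinks
(`SolvesInclusionOn.closedHull_subset`). The rule of choosing neighbors plays no role.

*Metric model.* The interactions are symmetric, so the average is constant, and the energy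
`∑ i, ‖x i‖ ^ 2` decreases at a rate at least `a r * r ^ 2` for every pair at distance `r < 1`. As
trajectories are Lipschitz and the energy converges, every distance either tends to zero or is
eventually greater than `1 - ε` for each `ε > 0`
(`tendsto_zero_or_eventually_gt_of_dissipation`). Call agents at vanishing distance a group. Between
different groups distances are eventually greater than `1 / 2`, where the speed of interaction
`a r * r` is at most `2 * (a r * r ^ 2)`; the interactions inside a group do not move its
barycenter. So the energy controls the length of the trajectory of the barycenter, which
converges, and the agents of the group converge with it
(`IsGlobalKrasovskySolution.convergesToClusterPoint_metric`).

*One neighbor.* Let `d i` be the distance of agent `i` from the nearest other agent and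
`φ r = a r * r`, so that `i` has speed `φ (d i)`. If `i` follows `j`, the derivative of `d i` is at
most `-φ (d i) + φ (d j)`, and at most `-φ (d i)` if `j` also follows `i`. At almost every time
agents with equal `d` have equal derivatives of `d`, and because ties are resolved by the index, a
class of agents with equal `d` contains two that follow each other unless one of its agents follows
an agent with a smaller `d`. Hence the sum of all `d i` decreases at least at the rate `φ (d i)`,
for every `i` (`sum_rate_le_neg`). It bounds the lengths of the trajectories, which therefore
converge, and forces each `d i` to tend to zero
(`IsGlobalCaratheodorySolution.convergesToClusterPoint_topological`).

*Counterexamples.* All have `a = 1` and agents on the line. An agent approaching two agents at rest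
moves the average. An agent halfway between two pairs of agents may rest as a Krasovsky solution
with `κ = 1`; an agent halfway between two triples rests as a Caratheodory solution with `κ = 2` if
its neighbors are one agent from each side.
-/

/-! ### Absolutely continuous functions and bounds on their derivatives -/

section AbsoluteContinuity

theorem LocallyLipschitz.comp_absolutelyContinuousOnInterval {X Y : Type*}
    [SeminormedAddCommGroup X] [PseudoMetricSpace Y] {Φ : X → Y} (hΦ : LocallyLipschitz Φ) {x : ℝ → X}
    {a b : ℝ} (hx : AbsolutelyContinuousOnInterval x a b) :
    AbsolutelyContinuousOnInterval (fun t => Φ (x t)) a b := by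
  obtain ⟨K, hK⟩ := (hΦ.locallyLipschitzOn (s := x '' uIcc a b)).exists_lipschitzOnWith_of_compact
    (isCompact_uIcc.image_of_continuousOn hx.continuousOn)
  unfold AbsolutelyContinuousOnInterval at hx ⊢
  have hlim := hx.const_mul (K : ℝ)
  rw [mul_zero] at hlim
  refine squeeze_zero' (.of_forall fun _ => Finset.sum_nonneg fun _ _ => dist_nonneg) ?_ hlim
  rw [eventually_inf_principal]
  filter_upwards with E hE
  rw [Finset.mul_sum]
  exact Finset.sum_le_sum fun i hi =>
    hK.dist_le_mul _ (mem_image_of_mem _ (hE.1 i hi).1) _ (mem_image_of_mem _ (hE.1 i hi).2)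

theorem AbsolutelyContinuousOnInterval.sub_le_mul_of_ae_deriv_le {f : ℝ → ℝ} {a b m : ℝ}
    (hf : AbsolutelyContinuousOnInterval f a b) (hab : a ≤ b)
    (h : ∀ᵐ t, t ∈ Icc a b → ∀ c, HasDerivAt f c t → c ≤ m) : f b - f a ≤ m * (b - a) := by
  rw [← hf.integral_deriv_eq_sub]
  calc ∫ t in a..b, deriv f t ≤ ∫ _ in a..b, m := by
        refine intervalIntegral.integral_mono_ae_restrict hab hf.intervalIntegrable_deriv
          intervalIntegrable_const ?_
        rw [EventuallyLE, ae_restrict_iff' measurableSet_Icc]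
        filter_upwards [h, hf.ae_differentiableAt] with t ht hd hmem
        exact ht hmem _ (hd (by rwa [uIcc_of_le hab])).hasDerivAt
    _ = m * (b - a) := by simp [mul_comm]

theorem AbsolutelyContinuousOnInterval.norm_sub_le_of_ae_norm_deriv_le {E : Type*}
    [NormedAddCommGroup E] [InnerProductSpace ℝ E] {f : ℝ → E} {D : ℝ → ℝ} {a b : ℝ}
    (hf : AbsolutelyContinuousOnInterval f a b) (hD : AbsolutelyContinuousOnInterval D a b)
    (hab : a ≤ b)
    (h : ∀ᵐ t, t ∈ Icc a b → ∃ v, HasDerivAt f v t ∧ ∀ c, HasDerivAt D c t → ‖v‖ ≤ c) :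
    ‖f b - f a‖ ≤ D b - D a := by
  -- Scalarize: it suffices to bound the increment of `f` in its own direction `w`.
  set w := f b - f a with hw
  have hfw : AbsolutelyContinuousOnInterval (fun t => inner ℝ w (f t)) a b :=
    (innerSL ℝ w).lipschitz.locallyLipschitz.comp_absolutelyContinuousOnInterval hf
  have key := (hfw.fun_sub (hD.const_mul ‖w‖)).sub_le_mul_of_ae_deriv_le (m := 0) hab (by
    filter_upwards [h, hD.ae_differentiableAt] with t ht hDt hmem c hc
    obtain ⟨v, hv, hvc⟩ := ht hmem
    have hD' := (hDt (by rwa [uIcc_of_le hab])).hasDerivAt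
    have := ((innerSL ℝ w).hasFDerivAt.comp_hasDerivAt t hv).sub (hD'.const_mul ‖w‖)
    rw [hc.unique this]
    have h1 := hvc _ hD'
    have h2 : inner ℝ w v ≤ ‖w‖ * ‖v‖ := real_inner_le_norm w v
    have h3 := mul_le_mul_of_nonneg_left h1 (norm_nonneg w)
    simp only [innerSL_apply_apply]
    linarith)
  have h1 : inner ℝ w (f b) - inner ℝ w (f a) = ‖w‖ * ‖w‖ := by
    rw [← inner_sub_right, ← hw, real_inner_self_eq_norm_mul_norm]
  rcases (norm_nonneg w).eq_or_lt with h0 | h0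
  · rw [← h0] at key ⊢
    have := (AbsolutelyContinuousOnInterval.sub_le_mul_of_ae_deriv_le (m := 0) hD.neg hab (by
      filter_upwards [h] with t ht hmem c hc
      obtain ⟨v, -, hvc⟩ := ht hmem
      have := hvc (-c) (by simpa using hc.neg)
      linarith [norm_nonneg v]))
    simp only [Pi.neg_apply] at this
    linarith
  · have : ‖w‖ * (‖w‖ - (D b - D a)) ≤ 0 := by linarith
    nlinarith

/-- The envelope principle: if `g` touches `f` from below, the two have the same derivative. -/
theorem HasDerivAt.eq_of_le_of_eq {f g : ℝ → ℝ} {c d t : ℝ} (hf : HasDerivAt f c t)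
    (hg : HasDerivAt g d t) (hle : ∀ s, g s ≤ f s) (heq : f t = g t) : c = d := by
  have hmin : IsLocalMin (fun s => f s - g s) t :=
    .of_forall fun s => by simpa [heq] using hle s
  exact sub_eq_zero.1 (hmin.hasDerivAt_eq_zero (hf.sub hg))

/-- At a point where two functions agree, they have the same derivative as soon as the absolute
value of their difference is differentiable: that absolute value has a minimum there. -/
theorem HasDerivAt.eq_of_differentiableAt_abs_sub {f g : ℝ → ℝ} {c d t : ℝ}
    (hf : HasDerivAt f c t) (hg : HasDerivAt g d t)
    (h : DifferentiableAt ℝ (fun s => |f s - g s|) t) (heq : f t = g t) : c = d := by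
  have hmin : IsLocalMin (fun s => |f s - g s|) t := .of_forall fun s => by simp [heq]
  have h0 : HasDerivAt (fun s => |f s - g s|) 0 t := by
    simpa [hmin.deriv_eq_zero] using h.hasDerivAt
  have h1 : HasDerivAt (fun s => f s - g s) 0 t := by
    rw [hasDerivAt_iff_isLittleO] at h0 ⊢
    simp only [heq, sub_self, abs_zero, sub_zero, smul_zero] at h0 ⊢
    exact Asymptotics.isLittleO_norm_left.1 h0
  have := h1.unique (hf.sub hg)
  linarith

theorem exists_tendsto_of_antitoneOn_of_nonneg {D : ℝ → ℝ} {T : ℝ} (hD : ∀ t, T ≤ t → 0 ≤ D t)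
    (h : AntitoneOn D (Ici T)) : ∃ l, Tendsto D atTop (𝓝 l) := by
  have hanti : Antitone fun t => D (max t T) := fun s t hst =>
    h (mem_Ici.2 (le_max_right _ _)) (mem_Ici.2 (le_max_right _ _)) (max_le_max hst le_rfl)
  refine ⟨_, (tendsto_atTop_ciInf hanti ⟨0, ?_⟩).congr' ?_⟩
  · rintro _ ⟨t, rfl⟩
    exact hD _ (le_max_right _ _)
  · filter_upwards [eventually_ge_atTop T] with t ht
    rw [max_eq_left ht]

/-- A function whose increments are controlled by the decrements of a real function bounded below
has finite length, hence a limit. -/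
theorem exists_tendsto_of_norm_sub_le {E : Type*} [NormedAddCommGroup E] [CompleteSpace E]
    {f : ℝ → E} {D : ℝ → ℝ} {T : ℝ} (hD : ∀ t, T ≤ t → 0 ≤ D t)
    (h : ∀ s t, T ≤ s → s ≤ t → ‖f t - f s‖ ≤ D s - D t) : ∃ y, Tendsto f atTop (𝓝 y) := by
  obtain ⟨l, hl⟩ := exists_tendsto_of_antitoneOn_of_nonneg hD fun s hs t _ hst => by
    linarith [h s t hs hst, norm_nonneg (f t - f s)]
  refine cauchySeq_tendsto_of_complete (Metric.cauchySeq_iff'.2 fun ε hε => ?_)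
  obtain ⟨P, hP⟩ : ∃ P, ∀ n ≥ P, dist (D n) (D P) < ε ∧ T ≤ P := by
    obtain ⟨P, hP⟩ := Metric.cauchySeq_iff.1 hl.cauchySeq ε hε
    exact ⟨max P T, fun n hn =>
      ⟨hP n ((le_max_left _ _).trans hn) _ (le_max_left _ _), le_max_right _ _⟩⟩
  refine ⟨P, fun n hn => ?_⟩
  rw [dist_eq_norm]
  have h1 := (hP n hn).1
  rw [Real.dist_eq, abs_sub_comm] at h1
  exact (h P n (hP n hn).2 hn).trans_lt ((le_abs_self _).trans_lt h1)

end AbsoluteContinuity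

/-! ### Solutions of differential inclusions -/

section Inclusions

variable {X : Type*} [NormedAddCommGroup X] [NormedSpace ℝ X]

/-- Absolutely continuous solutions of `ẋ ∈ F(x)` on `[a, b]`. Caratheodory solutions are those
for `F x = {g x}`, Krasovsky solutions those for `F = krasovsky g`. -/
def SolvesInclusionOn (F : X → Set X) (a b : ℝ) (x : ℝ → X) : Prop :=
  AbsolutelyContinuousOnInterval x a b ∧
    ∀ᵐ t, t ∈ Icc a b → ∃ v ∈ F (x t), HasDerivAt x v t

theorem SolvesInclusionOn.mono {F : X → Set X} {a b a' b' : ℝ} {x : ℝ → X}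
    (h : SolvesInclusionOn F a b x) (ha : a ≤ a') (hab : a' ≤ b') (hb : b' ≤ b) :
    SolvesInclusionOn F a' b' x := by
  refine ⟨h.1.mono ?_, ?_⟩
  · rw [uIcc_of_le hab, uIcc_of_le (ha.trans (hab.trans hb))]
    exact Icc_subset_Icc ha hb
  · filter_upwards [h.2] with t ht hmem using ht (Icc_subset_Icc ha hb hmem)

theorem IsKrasovskySolution.solvesInclusionOn {g : X → X} {T : ℝ} {x : ℝ → X}
    (h : IsKrasovskySolution g T x) : SolvesInclusionOn (krasovsky g) 0 T x :=
  ⟨h.1, (ae_restrict_iff' measurableSet_Icc).1 h.2⟩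

theorem IsCaratheodorySolution.solvesInclusionOn {g : X → X} {T : ℝ} {x : ℝ → X}
    (h : IsCaratheodorySolution g T x) : SolvesInclusionOn (fun y => {g y}) 0 T x := by
  refine ⟨h.1, ?_⟩
  filter_upwards [(ae_restrict_iff' measurableSet_Icc).1 h.2] with t ht hmem
  exact ⟨_, rfl, ht hmem⟩

theorem mem_krasovsky_self (g : X → X) (x : X) : g x ∈ krasovsky g x :=
  mem_iInter₂.2 fun _ hδ => subset_closure <| subset_convexHull ℝ _ <|
    mem_image_of_mem g (Metric.mem_ball_self hδ)

theorem IsCaratheodorySolution.isKrasovskySolution {g : X → X} {T : ℝ} {x : ℝ → X}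
    (h : IsCaratheodorySolution g T x) : IsKrasovskySolution g T x :=
  ⟨h.1, h.2.mono fun _ ht => ⟨_, mem_krasovsky_self g _, ht⟩⟩

theorem IsGlobalKrasovskySolution.solvesInclusionOn {g : X → X} {x : ℝ → X}
    (h : IsGlobalKrasovskySolution g x) {a b : ℝ} (ha : 0 ≤ a) (hab : a ≤ b) :
    SolvesInclusionOn (krasovsky g) a b x :=
  (h (b + 1) (by linarith)).solvesInclusionOn.mono ha hab (by linarith)

theorem IsGlobalCaratheodorySolution.solvesInclusionOn {g : X → X} {x : ℝ → X}
    (h : IsGlobalCaratheodorySolution g x) {a b : ℝ} (ha : 0 ≤ a) (hab : a ≤ b) :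
    SolvesInclusionOn (fun y => {g y}) a b x :=
  (h (b + 1) (by linarith)).solvesInclusionOn.mono ha hab (by linarith)

/-- Bounds on `φ ∘ g` near `x`, with `φ` convex, pass to the Krasovsky velocities at `x`. -/
theorem le_of_mem_krasovsky {g : X → X} {x v : X} (hv : v ∈ krasovsky g x) {φ F : X → ℝ}
    (hφ : ConvexOn ℝ univ φ) (hφc : Continuous φ) (hF : ContinuousAt F x)
    (h : ∀ᶠ z in 𝓝 x, φ (g z) ≤ F z) : φ v ≤ F x := by
  refine le_of_forall_pos_le_add fun ε hε => ?_
  have hF' : ∀ᶠ z in 𝓝 x, F z < F x + ε := hF.eventually_lt_const (by linarith)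
  obtain ⟨δ, hδ, hball⟩ := Metric.eventually_nhds_iff_ball.1 (h.and hF')
  have hclosed : IsClosed {w | φ w ≤ F x + ε} := isClosed_le hφc continuous_const
  have hconv : Convex ℝ {w | φ w ≤ F x + ε} := by simpa using hφ.convex_le (F x + ε)
  refine closure_minimal (convexHull_min ?_ hconv) hclosed (mem_iInter₂.1 hv δ hδ)
  rintro _ ⟨z, hz, rfl⟩
  exact (hball z hz).1.trans (hball z hz).2.le

variable {F : X → Set X} {a b : ℝ} {x : ℝ → X}

theorem SolvesInclusionOn.comp_sub_le (h : SolvesInclusionOn F a b x) (hab : a ≤ b) {Φ : X → ℝ}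
    (hΦ : LocallyLipschitz Φ) {m : ℝ}
    (hd : ∀ t ∈ Icc a b, ∀ v ∈ F (x t), ∀ c, HasDerivAt x v t →
      HasDerivAt (fun s => Φ (x s)) c t → c ≤ m) :
    Φ (x b) - Φ (x a) ≤ m * (b - a) := by
  refine (hΦ.comp_absolutelyContinuousOnInterval h.1).sub_le_mul_of_ae_deriv_le hab ?_
  filter_upwards [h.2] with t ht hmem c hc
  obtain ⟨v, hv, hxv⟩ := ht hmem
  exact hd t hmem v hv c hxv hc

variable {E : Type*} [NormedAddCommGroup E] [InnerProductSpace ℝ E]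

theorem SolvesInclusionOn.norm_map_sub_le (h : SolvesInclusionOn F a b x) (hab : a ≤ b)
    {Φ : X → ℝ} (hΦ : LocallyLipschitz Φ) (L : X →L[ℝ] E)
    (hd : ∀ t ∈ Icc a b, ∀ v ∈ F (x t), ∀ c, HasDerivAt x v t →
      HasDerivAt (fun s => Φ (x s)) c t → ‖L v‖ ≤ -c) :
    ‖L (x b) - L (x a)‖ ≤ Φ (x a) - Φ (x b) := by
  have := (L.lipschitz.locallyLipschitz.comp_absolutelyContinuousOnInterval
    h.1).norm_sub_le_of_ae_norm_deriv_le
      (hΦ.comp_absolutelyContinuousOnInterval h.1).fun_neg hab (by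
    filter_upwards [h.2] with t ht hmem
    obtain ⟨v, hv, hxv⟩ := ht hmem
    refine ⟨L v, L.hasFDerivAt.comp_hasDerivAt t hxv, fun c hc => ?_⟩
    simpa using hd t hmem v hv (-c) hxv (by simpa using hc.fun_neg))
  linarith

theorem SolvesInclusionOn.norm_map_sub_le_mul (h : SolvesInclusionOn F a b x) (hab : a ≤ b)
    (L : X →L[ℝ] E) {M : ℝ} (hd : ∀ t ∈ Icc a b, ∀ v ∈ F (x t), ‖L v‖ ≤ M) :
    ‖L (x b) - L (x a)‖ ≤ M * (b - a) := by
  have hM : AbsolutelyContinuousOnInterval (fun t => M * t) a b :=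
    ContDiffOn.absolutelyContinuousOnInterval (by fun_prop)
  have := (L.lipschitz.locallyLipschitz.comp_absolutelyContinuousOnInterval
    h.1).norm_sub_le_of_ae_norm_deriv_le hM hab (by
    filter_upwards [h.2] with t ht hmem
    obtain ⟨v, hv, hxv⟩ := ht hmem
    refine ⟨L v, L.hasFDerivAt.comp_hasDerivAt t hxv, fun c hc => ?_⟩
    have : HasDerivAt (fun t => M * t) M t := by simpa using (hasDerivAt_id t).const_mul M
    rw [hc.unique this]
    exact hd t hmem v hv)
  linarith

end Inclusions

/-! ### Contraction of the support -/

section Support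

variable {n N : ℕ} {a : ℝ≥0 → ℝ≥0} {nbr : State n N → Fin N → Finset (Fin N)}

theorem IsInteractionFunction.continuous (ha : IsInteractionFunction a) : Continuous a :=
  ha.lipschitz.choose_spec.continuous

/-- An upper bound for the speed of agent `i`, continuous in the state. -/
noncomputable def maxSpeed (a : ℝ≥0 → ℝ≥0) (i : Fin N) (y : State n N) : ℝ :=
  ∑ j, (a ‖y j - y i‖₊ : ℝ) * ‖y j - y i‖

theorem continuous_maxSpeed (ha : Continuous a) (i : Fin N) :
    Continuous (maxSpeed (n := n) a i) := by
  unfold maxSpeed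
  fun_prop

theorem norm_opinionField_le (y : State n N) (i : Fin N) :
    ‖opinionField a nbr y i‖ ≤ maxSpeed a i y := by
  refine (norm_sum_le _ _).trans ?_
  simp only [norm_smul, Real.norm_eq_abs, NNReal.abs_eq]
  exact Finset.sum_le_sum_of_subset_of_nonneg (Finset.subset_univ _) fun _ _ _ => by positivity

/-- An agent that is extreme in the direction `p` does not move further in this direction. -/
theorem apply_nonpos_of_mem_krasovsky_of_isMax (ha : IsInteractionFunction a) {x v : State n N}
    (hv : v ∈ krasovsky (opinionField a nbr) x) (p : StrongDual ℝ (EuclideanSpace ℝ (Fin n)))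
    {i : Fin N} (hi : ∀ j, p (x j) ≤ p (x i)) : p (v i) ≤ 0 := by
  have hac := ha.continuous
  let F : State n N → ℝ := fun z => ∑ j, (a ‖z j - z i‖₊ : ℝ) * max 0 (p (z j - z i))
  have hF : Continuous F := by fun_prop
  have hFx : F x = 0 := Finset.sum_eq_zero fun j _ => by
    rw [max_eq_left (by simpa using hi j), mul_zero]
  rw [← hFx]
  let φ : State n N →L[ℝ] ℝ := p ∘L ContinuousLinearMap.proj i
  refine le_of_mem_krasovsky (φ := φ) hv (φ.toLinearMap.convexOn convex_univ) φ.continuous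
    hF.continuousAt (.of_forall fun z => ?_)
  simp only [φ, F, opinionField, ContinuousLinearMap.comp_apply, ContinuousLinearMap.proj_apply,
    map_sum, map_smul, smul_eq_mul]
  calc ∑ j ∈ nbr z i, (a ‖z j - z i‖₊ : ℝ) * p (z j - z i)
      ≤ ∑ j ∈ nbr z i, (a ‖z j - z i‖₊ : ℝ) * max 0 (p (z j - z i)) :=
        Finset.sum_le_sum fun j _ => mul_le_mul_of_nonneg_left (le_max_right _ _) (by positivity)
    _ ≤ _ := Finset.sum_le_sum_of_subset_of_nonneg (Finset.subset_univ _)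
        fun _ _ _ => by positivity

theorem lipschitzWith_iSup_apply [Nonempty (Fin N)]
    (p : StrongDual ℝ (EuclideanSpace ℝ (Fin n))) :
    LipschitzWith ‖p‖₊ fun y : State n N => ⨆ i, p (y i) := by
  refine .of_le_add_mul _ fun y z => ciSup_le fun i => ?_
  have h1 : p (y i) - p (z i) ≤ ‖p‖ * dist y z := by
    rw [← map_sub]
    refine (le_abs_self _).trans ((p.le_opNorm _).trans ?_)
    rw [← dist_eq_norm]
    exact mul_le_mul_of_nonneg_left (dist_le_pi_dist y z i) (norm_nonneg _)
  have h2 : p (z i) ≤ ⨆ i, p (z i) := le_ciSup (finite_range fun i => p (z i)).bddAbove i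
  rw [coe_nnnorm]
  linarith

theorem SolvesInclusionOn.iSup_apply_le [Nonempty (Fin N)] (ha : IsInteractionFunction a)
    {s t : ℝ} {x : ℝ → State n N} (h : SolvesInclusionOn (krasovsky (opinionField a nbr)) s t x)
    (hst : s ≤ t) (p : StrongDual ℝ (EuclideanSpace ℝ (Fin n))) :
    ⨆ i, p (x t i) ≤ ⨆ i, p (x s i) := by
  have := h.comp_sub_le hst (lipschitzWith_iSup_apply p).locallyLipschitz (m := 0)
    fun τ _ v hv c hxv hc => by
      obtain ⟨i, hi⟩ := exists_eq_ciSup_of_finite (f := fun i => p (x τ i))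
      have hle (s i) : p (x s i) ≤ ⨆ i, p (x s i) :=
        le_ciSup (finite_range fun i => p (x s i)).bddAbove i
      have hpi : HasDerivAt (fun s => p (x s i)) (p (v i)) τ :=
        p.hasFDerivAt.comp_hasDerivAt τ (hasDerivAt_pi.1 hxv i)
      rw [hc.eq_of_le_of_eq hpi (fun s => hle s i) hi.symm]
      exact apply_nonpos_of_mem_krasovsky_of_isMax ha hv p fun j => by
        rw [hi]
        exact hle τ j
  linarith

theorem SolvesInclusionOn.closedHull_subset (ha : IsInteractionFunction a)
    {s t : ℝ} {x : ℝ → State n N} (h : SolvesInclusionOn (krasovsky (opinionField a nbr)) s t x)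
    (hst : s ≤ t) : closedHull (range (x t)) ⊆ closedHull (range (x s)) := by
  refine closure_minimal (convexHull_min ?_ (convex_convexHull ℝ _).closure) isClosed_closure
  rintro _ ⟨i, rfl⟩
  by_contra hi
  have : Nonempty (Fin N) := ⟨i⟩
  obtain ⟨p, u, hu, hpu⟩ :=
    geometric_hahn_banach_closed_point (convex_convexHull ℝ _).closure isClosed_closure hi
  have h1 : ⨆ j, p (x s j) ≤ u := ciSup_le fun j =>
    (hu _ (subset_closure (subset_convexHull ℝ _ (mem_range_self j)))).le
  have h2 := h.iSup_apply_le ha hst p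
  have h3 : p (x t i) ≤ ⨆ j, p (x t j) := le_ciSup (finite_range fun j => p (x t j)).bddAbove i
  linarith

end Support

/-! ### The metric vector field and its Krasovsky velocities -/

section MetricField

variable {n N : ℕ} {a : ℝ≥0 → ℝ≥0}

/-- The strength of the interaction of the agents `i` and `j` in the metric model. It is symmetric
in the two agents. -/
noncomputable def metricWeight (a : ℝ≥0 → ℝ≥0) (y : State n N) (i j : Fin N) : ℝ :=
  if ‖y j - y i‖ < 1 then (a ‖y j - y i‖₊ : ℝ) else 0

theorem metricWeight_comm (y : State n N) (i j : Fin N) :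
    metricWeight a y i j = metricWeight a y j i := by
  have h : ‖y j - y i‖₊ = ‖y i - y j‖₊ := Subtype.ext (norm_sub_rev _ _)
  simp only [metricWeight, h, norm_sub_rev (y j) (y i)]

theorem metricWeight_nonneg (y : State n N) (i j : Fin N) : 0 ≤ metricWeight a y i j := by
  unfold metricWeight
  split_ifs <;> positivity

theorem metricField_apply (y : State n N) (i : Fin N) :
    metricField a y i = ∑ j, metricWeight a y i j • (y j - y i) := by
  simp [metricField, opinionField, metricNeighbors, metricWeight, Finset.sum_filter, ite_smul]

/-- The interactions inside a group of agents cancel in the sum of their velocities. -/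
theorem sum_metricField (y : State n N) (C : Finset (Fin N)) :
    ∑ i ∈ C, metricField a y i = ∑ i ∈ C, ∑ j ∈ Cᶜ, metricWeight a y i j • (y j - y i) := by
  have hanti : ∑ i ∈ C, ∑ j ∈ C, metricWeight a y i j • (y j - y i) = 0 := by
    have h : ∑ i ∈ C, ∑ j ∈ C, metricWeight a y i j • (y j - y i) =
        -∑ i ∈ C, ∑ j ∈ C, metricWeight a y i j • (y j - y i) := by
      conv_lhs => rw [Finset.sum_comm]
      simp only [← Finset.sum_neg_distrib, ← smul_neg, neg_sub]
      exact Finset.sum_congr rfl fun i _ => Finset.sum_congr rfl fun j _ => by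
        rw [metricWeight_comm]
    rw [eq_neg_iff_add_eq_zero, ← two_smul ℝ] at h
    exact (smul_eq_zero_iff_right two_ne_zero).1 h
  simp only [metricField_apply]
  rw [← zero_add (∑ i ∈ C, ∑ j ∈ Cᶜ, _), ← hanti, ← Finset.sum_add_distrib]
  exact Finset.sum_congr rfl fun i _ => (Finset.sum_add_sum_compl C _).symm

theorem sum_inner_metricField (y : State n N) :
    2 * ∑ i, inner ℝ (y i) (metricField a y i) =
      -∑ i, ∑ j, metricWeight a y i j * ‖y j - y i‖ ^ 2 := by
  have h1 : ∑ i, inner ℝ (y i) (metricField a y i) =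
      ∑ i, ∑ j, metricWeight a y i j * inner ℝ (y i) (y j - y i) := by
    simp only [metricField_apply, inner_sum, inner_smul_right]
  have h2 : ∑ i, inner ℝ (y i) (metricField a y i) =
      ∑ i, ∑ j, metricWeight a y i j * inner ℝ (y j) (y i - y j) := by
    rw [h1, Finset.sum_comm]
    exact Finset.sum_congr rfl fun i _ => Finset.sum_congr rfl fun j _ => by
      rw [metricWeight_comm]
  rw [two_mul]
  nth_rw 1 [h1]
  rw [h2]
  simp only [← Finset.sum_add_distrib, ← Finset.sum_neg_distrib, ← mul_add, ← mul_neg]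
  refine Finset.sum_congr rfl fun i _ => Finset.sum_congr rfl fun j _ => ?_
  rw [← real_inner_self_eq_norm_sq, ← neg_sub (y j) (y i), inner_neg_right, inner_sub_left]
  ring_nf

/-- The error made when `y` is replaced by a fixed state `x` in `∑ i, ⟪y i, g i⟫`. -/
theorem sum_inner_le_add {g : State n N} (x y : State n N) (hg : ∀ i, ‖g i‖ ≤ maxSpeed a i y) :
    ∑ i, inner ℝ (x i) (g i) ≤
      ∑ i, inner ℝ (y i) (g i) + ∑ i, ‖x i - y i‖ * maxSpeed a i y := by
  rw [← Finset.sum_add_distrib]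
  refine Finset.sum_le_sum fun i _ => ?_
  have h1 : inner ℝ (x i - y i) (g i) ≤ ‖x i - y i‖ * ‖g i‖ := real_inner_le_norm _ _
  have h2 := mul_le_mul_of_nonneg_left (hg i) (norm_nonneg (x i - y i))
  rw [inner_sub_left] at h1
  linarith

/-- The linear functional `∑ i, ⟪x i, v i⟫` of the velocities `v`. -/
noncomputable def innerState (x : State n N) : State n N →L[ℝ] ℝ :=
  ∑ i, innerSL ℝ (x i) ∘L ContinuousLinearMap.proj i

theorem innerState_apply (x v : State n N) : innerState x v = ∑ i, inner ℝ (x i) (v i) := by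
  simp [innerState]

/-- The sum of the states over a group of agents. -/
noncomputable def groupSum (C : Finset (Fin N)) : State n N →L[ℝ] EuclideanSpace ℝ (Fin n) :=
  ∑ i ∈ C, ContinuousLinearMap.proj i

theorem groupSum_apply (C : Finset (Fin N)) (v : State n N) : groupSum C v = ∑ i ∈ C, v i := by
  simp [groupSum]

variable {x v : State n N}

theorem sum_eq_zero_of_mem_krasovsky (hv : v ∈ krasovsky (metricField a) x) : ∑ i, v i = 0 := by
  have := le_of_mem_krasovsky (φ := fun v => ‖groupSum Finset.univ v‖) (F := fun _ => 0) hv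
    ((convexOn_norm convex_univ).comp_linearMap (groupSum Finset.univ).toLinearMap)
    (by fun_prop) continuousAt_const
    (.of_forall fun z => by rw [groupSum_apply, sum_metricField]; simp)
  rw [groupSum_apply] at this
  exact norm_le_zero_iff.1 this

theorem norm_le_of_mem_krasovsky (ha : IsInteractionFunction a)
    (hv : v ∈ krasovsky (metricField a) x) (i : Fin N) : ‖v i‖ ≤ maxSpeed a i x := by
  let L : State n N →L[ℝ] EuclideanSpace ℝ (Fin n) := ContinuousLinearMap.proj i
  exact le_of_mem_krasovsky (φ := fun v => ‖L v‖) (F := maxSpeed a i) hv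
    ((convexOn_norm convex_univ).comp_linearMap L.toLinearMap) (by fun_prop)
    (continuous_maxSpeed ha.continuous i).continuousAt
    (.of_forall fun z => norm_opinionField_le (nbr := metricNeighbors) z i)

theorem continuous_sum_norm_sub_mul_maxSpeed (ha : IsInteractionFunction a) (x : State n N) :
    Continuous fun z : State n N => ∑ i, ‖x i - z i‖ * maxSpeed a i z := by
  have := continuous_maxSpeed (n := n) (N := N) ha.continuous
  fun_prop

/-- Two agents at distance less than one dissipate energy. -/
theorem sum_inner_le_of_mem_krasovsky (ha : IsInteractionFunction a)
    (hv : v ∈ krasovsky (metricField a) x) {i j : Fin N} (hij : ‖x j - x i‖ < 1) :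
    2 * ∑ k, inner ℝ (x k) (v k) ≤ -((a ‖x j - x i‖₊ : ℝ) * ‖x j - x i‖ ^ 2) := by
  have hac := ha.continuous
  let F : State n N → ℝ := fun z =>
    -((a ‖z j - z i‖₊ : ℝ) * ‖z j - z i‖ ^ 2) / 2 + ∑ k, ‖x k - z k‖ * maxSpeed a k z
  have hF : Continuous F := by
    have := continuous_sum_norm_sub_mul_maxSpeed ha x
    fun_prop
  have hopen : ∀ᶠ z : State n N in 𝓝 x, ‖z j - z i‖ < 1 :=
    (by fun_prop : Continuous fun z : State n N => ‖z j - z i‖).continuousAt.eventually_lt_const hij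
  have := le_of_mem_krasovsky (φ := innerState x) (F := F) hv
    ((innerState x).toLinearMap.convexOn convex_univ) (by fun_prop) hF.continuousAt (by
    filter_upwards [hopen] with z hz
    have h1 := sum_inner_le_add (a := a) x z (norm_opinionField_le (nbr := metricNeighbors) z)
    have h2 := sum_inner_metricField (a := a) z
    have h3 : (a ‖z j - z i‖₊ : ℝ) * ‖z j - z i‖ ^ 2 ≤
        ∑ i, ∑ j, metricWeight a z i j * ‖z j - z i‖ ^ 2 := by
      have hnn (i j : Fin N) : 0 ≤ metricWeight a z i j * ‖z j - z i‖ ^ 2 :=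
        mul_nonneg (metricWeight_nonneg z i j) (by positivity)
      calc _ = metricWeight a z i j * ‖z j - z i‖ ^ 2 := by rw [metricWeight, if_pos hz]
        _ ≤ ∑ j, metricWeight a z i j * ‖z j - z i‖ ^ 2 :=
          Finset.single_le_sum (fun j _ => hnn i j) (Finset.mem_univ j)
        _ ≤ _ := Finset.single_le_sum (f := fun i => ∑ j, metricWeight a z i j * ‖z j - z i‖ ^ 2)
          (fun i _ => Finset.sum_nonneg fun j _ => hnn i j) (Finset.mem_univ i)
    simp only [innerState_apply, F]
    change ∑ k, inner ℝ (x k) (metricField a z k) ≤ ∑ k, inner ℝ (z k) (metricField a z k) + _ at h1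
    linarith)
  simp only [innerState_apply, F, sub_self, norm_zero, zero_mul, Finset.sum_const_zero,
    add_zero] at this
  linarith

/-- The speed of the barycenter of a group of agents far from the others is controlled by the
dissipation of energy: at distances `r ≥ 1 / 2`, one has `a r * r ≤ 2 * (a r * r ^ 2)`. -/
theorem norm_sum_le_of_mem_krasovsky (ha : IsInteractionFunction a)
    (hv : v ∈ krasovsky (metricField a) x) {C : Finset (Fin N)}
    (hC : ∀ i ∈ C, ∀ j ∉ C, 1 / 2 < ‖x j - x i‖) :
    ‖∑ i ∈ C, v i‖ ≤ -4 * ∑ i, inner ℝ (x i) (v i) := by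
  let F : State n N → ℝ := fun z => 4 * ∑ k, ‖x k - z k‖ * maxSpeed a k z
  have hF : Continuous F := by
    have := continuous_sum_norm_sub_mul_maxSpeed ha x
    fun_prop
  have hopen : ∀ᶠ z : State n N in 𝓝 x, ∀ i ∈ C, ∀ j ∈ Cᶜ, 1 / 2 < ‖z j - z i‖ := by
    simp only [Filter.eventually_all_finset]
    exact fun i hi j hj => (by fun_prop : Continuous fun z : State n N =>
      ‖z j - z i‖).continuousAt.eventually_const_lt (hC i hi j (Finset.mem_compl.1 hj))
  have := le_of_mem_krasovsky (φ := fun v => ‖groupSum C v‖ + ((4 : ℝ) • innerState x) v)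
    (F := F) hv
    (((convexOn_norm convex_univ).comp_linearMap (groupSum C).toLinearMap).add
      (((4 : ℝ) • innerState x).toLinearMap.convexOn convex_univ)) (by fun_prop)
    hF.continuousAt (by
    filter_upwards [hopen] with z hz
    have h1 := sum_inner_le_add (a := a) x z (norm_opinionField_le (nbr := metricNeighbors) z)
    change ∑ k, inner ℝ (x k) (metricField a z k) ≤ ∑ k, inner ℝ (z k) (metricField a z k) + _ at h1
    have h2 := sum_inner_metricField (a := a) z
    have h3 : ‖∑ i ∈ C, metricField a z i‖ ≤
        2 * ∑ i, ∑ j, metricWeight a z i j * ‖z j - z i‖ ^ 2 := by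
      rw [sum_metricField, Finset.mul_sum]
      have hnn (i j : Fin N) : 0 ≤ 2 * (metricWeight a z i j * ‖z j - z i‖ ^ 2) := by
        have := metricWeight_nonneg (a := a) z i j
        positivity
      calc _ ≤ ∑ i ∈ C, ∑ j ∈ Cᶜ, ‖metricWeight a z i j • (z j - z i)‖ :=
            (norm_sum_le _ _).trans (Finset.sum_le_sum fun i _ => norm_sum_le _ _)
        _ ≤ ∑ i ∈ C, ∑ j ∈ Cᶜ, 2 * (metricWeight a z i j * ‖z j - z i‖ ^ 2) := by
            refine Finset.sum_le_sum fun i hi => Finset.sum_le_sum fun j hj => ?_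
            have hw := metricWeight_nonneg (a := a) z i j
            have hd := hz i hi j hj
            rw [norm_smul, Real.norm_of_nonneg hw, mul_left_comm]
            gcongr
            nlinarith
        _ ≤ ∑ i ∈ C, 2 * ∑ j, metricWeight a z i j * ‖z j - z i‖ ^ 2 :=
            Finset.sum_le_sum fun i _ => by
              rw [Finset.mul_sum]
              exact Finset.sum_le_sum_of_subset_of_nonneg (Finset.subset_univ _)
                fun j _ _ => hnn i j
        _ ≤ _ := Finset.sum_le_sum_of_subset_of_nonneg (Finset.subset_univ _)
            fun i _ _ => by
              rw [Finset.mul_sum]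
              exact Finset.sum_nonneg fun j _ => hnn i j
    simp only [smul_apply, innerState_apply, groupSum_apply, smul_eq_mul, F]
    linarith)
  simp only [smul_apply, innerState_apply, groupSum_apply, smul_eq_mul, F,
    sub_self, norm_zero, zero_mul, Finset.sum_const_zero, mul_zero] at this
  linarith

end MetricField

/-! ### Convergence in the metric model -/

section MetricConvergence

/-- If a Lipschitz function `d` dissipates a convergent quantity `V` at a positive rate as long as
it stays in `[ε, 1 - ε]`, it leaves every such band for good, on one of the two sides. -/
theorem tendsto_zero_or_eventually_gt_of_dissipation {d V : ℝ → ℝ} {K l : ℝ} (hd0 : ∀ t, 0 ≤ d t)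
    (hd : ∀ s t, 0 ≤ s → s ≤ t → |d t - d s| ≤ K * (t - s)) (hV : Tendsto V atTop (𝓝 l))
    (hdiss : ∀ ε, 0 < ε → ∃ c > 0, ∀ s t, 0 ≤ s → s ≤ t →
      (∀ τ ∈ Icc s t, ε ≤ d τ ∧ d τ ≤ 1 - ε) → V t - V s ≤ -c * (t - s)) :
    Tendsto d atTop (𝓝 0) ∨ ∀ ε > 0, ∀ᶠ t in atTop, 1 - ε < d t := by
  have hcont : ContinuousOn d (Ici 0) := by
    intro s hs
    refine tendsto_iff_dist_tendsto_zero.2 (squeeze_zero' (.of_forall fun _ => dist_nonneg)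
      (g := fun t => K * |t - s|) ?_ ?_)
    · filter_upwards [self_mem_nhdsWithin] with t ht
      rw [Real.dist_eq]
      rcases le_total s t with h | h
      · simpa [abs_of_nonneg (sub_nonneg.2 h)] using hd s t hs h
      · rw [abs_sub_comm, abs_sub_comm t]
        simpa [abs_of_nonneg (sub_nonneg.2 h)] using hd t s ht h
    · exact ((by fun_prop : Continuous fun t => K * |t - s|).tendsto' s 0 (by simp)).mono_left
        nhdsWithin_le_nhds
  -- By the Lipschitz bound, a visit of `[ε, 1 - ε]` costs a fixed time in `[ε / 2, 1 - ε / 2]`.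
  have hband : ∀ ε > 0, ∀ᶠ t in atTop, d t < ε ∨ 1 - ε < d t := by
    intro ε hε
    obtain ⟨c, hc, hdc⟩ := hdiss (ε / 2) (by linarith)
    set τ := ε / 2 / (|K| + 1) with hτ
    have hτ0 : 0 < τ := by positivity
    have hKτ : |K| * τ ≤ ε / 2 := by
      rw [hτ, mul_div_assoc', div_le_iff₀ (by positivity)]
      nlinarith [abs_nonneg K]
    have hlim : Tendsto (fun t => V (t + τ) - V t) atTop (𝓝 (l - l)) :=
      (hV.comp (tendsto_atTop_add_const_right _ τ tendsto_id)).sub hV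
    have hsmall : ∀ᶠ t in atTop, -c * τ < V (t + τ) - V t :=
      hlim.eventually_const_lt (by nlinarith)
    filter_upwards [hsmall, eventually_ge_atTop 0] with t ht ht0
    by_contra! hmem
    have := hdc t (t + τ) ht0 (by linarith) fun s hs => by
      have h1 := hd t s ht0 hs.1
      have h2 : K * (s - t) ≤ |K| * τ :=
        mul_le_mul (le_abs_self K) (by linarith [hs.2]) (by linarith [hs.1]) (abs_nonneg K)
      have h3 := abs_le.1 (h1.trans (h2.trans hKτ))
      constructor <;> linarith [hmem.1, hmem.2, h3.1, h3.2]
    rw [add_sub_cancel_left] at this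
    linarith
  have hside : ∀ ε > 0, ε ≤ 1 / 4 → (∀ᶠ t in atTop, d t < ε) ∨ ∀ᶠ t in atTop, 1 - ε < d t := by
    intro ε hε hε4
    obtain ⟨T, hT⟩ := eventually_atTop.1 ((hband ε hε).and (eventually_ge_atTop 0))
    by_cases hex : ∃ s ≥ T, ε ≤ d s
    · obtain ⟨s, hs, hds⟩ := hex
      refine Or.inr (eventually_atTop.2 ⟨s, fun t ht => ?_⟩)
      refine ((hT t (hs.trans ht)).1.resolve_left fun hlt => ?_)
      obtain ⟨r, hr, hdr⟩ := intermediate_value_Icc' ht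
        (hcont.mono fun r hr => (hT s hs).2.trans hr.1) ⟨hlt.le, hds⟩
      rcases (hT r (hs.trans hr.1)).1 with h | h <;> linarith
    · push Not at hex
      exact Or.inl (eventually_atTop.2 ⟨T, hex⟩)
  by_cases hall : ∀ ε > 0, ε ≤ 1 / 4 → ∀ᶠ t in atTop, d t < ε
  · left
    refine Metric.tendsto_nhds.2 fun ε hε => ?_
    filter_upwards [hall (min ε (1 / 4)) (by positivity) (min_le_right _ _)] with t ht
    rw [Real.dist_eq, sub_zero, abs_of_nonneg (hd0 t)]
    exact ht.trans_le (min_le_left _ _)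
  · right
    push Not at hall
    obtain ⟨ε₀, hε₀, hε₀4, hnot⟩ := hall
    intro ε hε
    have hlow : ¬∀ᶠ t in atTop, d t < min ε ε₀ := fun h =>
      hnot (h.mono fun t ht => not_le.2 (ht.trans_le (min_le_right _ _)))
    filter_upwards [(hside (min ε ε₀) (by positivity)
      ((min_le_right _ _).trans hε₀4)).resolve_left hlow] with t ht
    linarith [min_le_left ε ε₀]

variable {n N : ℕ} {a : ℝ≥0 → ℝ≥0} {x : ℝ → State n N}

/-- The sum of the squared norms of the states. -/
noncomputable def energy (y : State n N) : ℝ := ∑ i, ‖y i‖ ^ 2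

theorem energy_nonneg (y : State n N) : 0 ≤ energy y :=
  Finset.sum_nonneg fun _ _ => by positivity

theorem contDiff_energy : ContDiff ℝ 1 (energy (n := n) (N := N)) :=
  ContDiff.sum fun i _ => (contDiff_apply ℝ (EuclideanSpace ℝ (Fin n)) i).norm_sq ℝ

theorem locallyLipschitz_energy : LocallyLipschitz (energy (n := n) (N := N)) :=
  contDiff_energy.locallyLipschitz

theorem hasDerivAt_energy {v : State n N} {t : ℝ} (h : HasDerivAt x v t) :
    HasDerivAt (fun s => energy (x s)) (2 * ∑ i, inner ℝ (x t i) (v i)) t := by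
  rw [Finset.mul_sum]
  exact HasDerivAt.fun_sum fun i _ => (hasDerivAt_pi.1 h i).norm_sq

theorem SolvesInclusionOn.energy_le {s t : ℝ}
    (ha : IsInteractionFunction a) (h : SolvesInclusionOn (krasovsky (metricField a)) s t x)
    (hst : s ≤ t) : energy (x t) ≤ energy (x s) := by
  have := h.comp_sub_le hst locallyLipschitz_energy (m := 0) fun τ _ v hv c hxv hc => by
    have := norm_sum_le_of_mem_krasovsky ha hv (C := Finset.univ) (by simp)
    rw [hc.unique (hasDerivAt_energy hxv)]
    linarith [norm_nonneg (∑ i, v i)]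
  linarith

theorem SolvesInclusionOn.average_eq {s t : ℝ}
    (h : SolvesInclusionOn (krasovsky (metricField a)) s t x) (hst : s ≤ t) :
    average (x t) = average (x s) := by
  have := h.norm_map_sub_le_mul hst (groupSum Finset.univ) (M := 0) fun τ _ v hv => by
    rw [groupSum_apply, sum_eq_zero_of_mem_krasovsky hv, norm_zero]
  rw [zero_mul] at this
  simp only [_root_.average]
  rw [← groupSum_apply, ← groupSum_apply, sub_eq_zero.1 (norm_le_zero_iff.1 this)]

/-- Trajectories of the metric model are Lipschitz: they stay in a ball, as the energy does not
increase. -/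
theorem IsGlobalKrasovskySolution.exists_metric_lipschitz (ha : IsInteractionFunction a)
    (h : IsGlobalKrasovskySolution (metricField a) x) :
    ∃ M, ∀ i s t, 0 ≤ s → s ≤ t → ‖x t i - x s i‖ ≤ M * (t - s) := by
  have hbdd : ∀ t, 0 ≤ t → x t ∈ Metric.closedBall (0 : State n N) √(energy (x 0)) := by
    intro t ht
    rw [mem_closedBall_zero_iff, pi_norm_le_iff_of_nonneg (Real.sqrt_nonneg _)]
    refine fun i => Real.le_sqrt_of_sq_le ?_
    exact (Finset.single_le_sum (f := fun i => ‖x t i‖ ^ 2) (fun _ _ => by positivity)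
      (Finset.mem_univ i)).trans ((h.solvesInclusionOn le_rfl ht).energy_le ha ht)
  have hspeed (i : Fin N) := (isCompact_closedBall (0 : State n N)
    √(energy (x 0))).exists_bound_of_continuousOn
      (continuous_maxSpeed ha.continuous i).continuousOn
  choose M hM using hspeed
  refine ⟨∑ i, |M i|, fun i s t hs hst => ?_⟩
  refine (h.solvesInclusionOn hs hst).norm_map_sub_le_mul hst
    (ContinuousLinearMap.proj (R := ℝ) (φ := fun _ : Fin N => EuclideanSpace ℝ (Fin n)) i)
    fun τ hτ v hv => ?_
  calc ‖v i‖ ≤ maxSpeed a i (x τ) := norm_le_of_mem_krasovsky ha hv i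
    _ ≤ M i := (le_abs_self _).trans (hM i _ (hbdd τ (hs.trans hτ.1)))
    _ ≤ |M i| := le_abs_self _
    _ ≤ ∑ i, |M i| := Finset.single_le_sum (f := fun i => |M i|) (fun _ _ => abs_nonneg _)
      (Finset.mem_univ i)

theorem IsGlobalKrasovskySolution.tendsto_norm_sub_or_eventually_gt (ha : IsInteractionFunction a)
    (h : IsGlobalKrasovskySolution (metricField a) x) (i j : Fin N) :
    Tendsto (fun t => ‖x t j - x t i‖) atTop (𝓝 0) ∨
      ∀ ε > 0, ∀ᶠ t in atTop, 1 - ε < ‖x t j - x t i‖ := by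
  obtain ⟨M, hM⟩ := h.exists_metric_lipschitz ha
  obtain ⟨l, hl⟩ := exists_tendsto_of_antitoneOn_of_nonneg (D := fun t => energy (x t)) (T := 0)
    (fun _ _ => energy_nonneg _)
    fun s hs t _ hst => (h.solvesInclusionOn hs hst).energy_le ha hst
  refine tendsto_zero_or_eventually_gt_of_dissipation (K := 2 * M) (fun _ => norm_nonneg _)
    (fun s t hs hst => ?_) hl fun ε hε => ?_
  · have h1 := hM i s t hs hst
    have h2 := hM j s t hs hst
    have h3 := abs_norm_sub_norm_le (x t j - x t i) (x s j - x s i)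
    have h4 := norm_sub_le (x t j - x s j) (x t i - x s i)
    rw [sub_sub_sub_comm] at h4
    linarith
  · have hpos : 0 < (a ⟨ε, hε.le⟩ : ℝ) := NNReal.coe_pos.2 (ha.pos _ hε)
    refine ⟨(a ⟨ε, hε.le⟩ : ℝ) * ε ^ 2, by positivity, fun s t hs hst hmem => ?_⟩
    refine (h.solvesInclusionOn hs hst).comp_sub_le hst locallyLipschitz_energy
      fun τ hτ v hv c hxv hc => ?_
    rw [hc.unique (hasDerivAt_energy hxv)]
    refine (sum_inner_le_of_mem_krasovsky ha hv (i := i) (j := j)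
      (by linarith [(hmem τ hτ).2])).trans (neg_le_neg ?_)
    have hmono : (a ⟨ε, hε.le⟩ : ℝ) ≤ a ‖x τ j - x τ i‖₊ :=
      NNReal.coe_le_coe.2 (ha.monotone (hmem τ hτ).1)
    gcongr
    exact (hmem τ hτ).1

/-- The agents at vanishing distance from each other form groups. From some time on different
groups are at distance more than `1 / 2`, so that the energy controls the length of the
trajectories of the barycenters of the groups. -/
theorem IsGlobalKrasovskySolution.convergesToClusterPoint_metric (ha : IsInteractionFunction a)
    (h : IsGlobalKrasovskySolution (metricField a) x) :
    ConvergesToClusterPoint metricNeighbors x := by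
  classical
  have hdich := h.tendsto_norm_sub_or_eventually_gt ha
  have hlim : ∀ i, ∃ y, Tendsto (fun t => x t i) atTop (𝓝 y) := by
    intro i
    let C : Finset (Fin N) :=
      Finset.univ.filter fun k => Tendsto (fun t => ‖x t k - x t i‖) atTop (𝓝 0)
    have hiC : i ∈ C := by simp [C]
    have hfar : ∀ᶠ t in atTop, ∀ k ∈ C, ∀ j ∈ Cᶜ, 1 / 2 < ‖x t j - x t k‖ := by
      simp only [Filter.eventually_all_finset]
      intro k hk j hj
      have hnot : ¬Tendsto (fun t => ‖x t j - x t k‖) atTop (𝓝 0) := fun hjk => by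
        refine Finset.mem_compl.1 hj (Finset.mem_filter.2 ⟨Finset.mem_univ _, ?_⟩)
        refine squeeze_zero (fun _ => norm_nonneg _)
          (fun t => norm_sub_le_norm_sub_add_norm_sub (x t j) (x t k) (x t i)) ?_
        simpa using hjk.add (Finset.mem_filter.1 hk).2
      filter_upwards [((hdich k j).resolve_left hnot) (1 / 2) (by norm_num)] with t ht
      linarith
    obtain ⟨T, hT⟩ := eventually_atTop.1 (hfar.and (eventually_ge_atTop 0))
    obtain ⟨y, hy⟩ := exists_tendsto_of_norm_sub_le (f := fun t => groupSum C (x t))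
      (D := fun t => 2 * energy (x t)) (T := T)
      (fun _ _ => mul_nonneg zero_le_two (energy_nonneg _)) fun s t hs hst => by
        refine (h.solvesInclusionOn (hT s hs).2 hst).norm_map_sub_le hst
          (Φ := fun y => 2 * energy y) (contDiff_const.mul contDiff_energy).locallyLipschitz
          (groupSum C) fun τ hτ v hv c hxv hc => ?_
        rw [hc.unique ((hasDerivAt_energy hxv).const_mul 2), groupSum_apply]
        have := norm_sum_le_of_mem_krasovsky ha hv fun k hk j hj =>
          (hT τ (hs.trans hτ.1)).1 k hk j (Finset.mem_compl.2 hj)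
        linarith
    have hsum : Tendsto (fun t => groupSum C (x t) - ∑ k ∈ C, (x t k - x t i)) atTop (𝓝 y) := by
      have : Tendsto (fun t => ∑ k ∈ C, (x t k - x t i)) atTop (𝓝 (∑ k ∈ C, 0)) :=
        tendsto_finsetSum _ fun k hk =>
          tendsto_zero_iff_norm_tendsto_zero.2 (Finset.mem_filter.1 hk).2
      simpa using hy.sub this
    refine ⟨(C.card : ℝ)⁻¹ • y, (hsum.const_smul (C.card : ℝ)⁻¹).congr fun t => ?_⟩
    have hcard : (C.card : ℝ) ≠ 0 := Nat.cast_ne_zero.2 (Finset.card_ne_zero_of_mem hiC)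
    rw [groupSum_apply, Finset.sum_sub_distrib, sub_sub_cancel, Finset.sum_const,
      ← Nat.cast_smul_eq_nsmul ℝ, inv_smul_smul₀ hcard]
  choose y hy using hlim
  refine ⟨y, fun i j hj => ?_, tendsto_pi_nhds.2 hy⟩
  have hlt : ‖y j - y i‖ < 1 := by simpa [metricNeighbors] using hj
  have hnorm : Tendsto (fun t => ‖x t j - x t i‖) atTop (𝓝 ‖y j - y i‖) := ((hy j).sub (hy i)).norm
  rcases hdich i j with h0 | h1
  · exact (sub_eq_zero.1 (norm_eq_zero.1 (tendsto_nhds_unique hnorm h0))).symm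
  · have : 1 ≤ ‖y j - y i‖ := le_of_forall_pos_le_add fun ε hε => by
      have := ge_of_tendsto hnorm ((h1 ε hε).mono fun t ht => ht.le)
      linarith
    linarith

end MetricConvergence

/-! ### Nearest neighbors -/

section NearestNeighbor

variable {n N : ℕ} {a : ℝ≥0 → ℝ≥0}

/-- The distance of agent `i` from the nearest other agent. -/
noncomputable def nearestDist (i : Fin N) (y : State n N) : ℝ :=
  ⨅ j : {j // j ≠ i}, ‖y j - y i‖

theorem nearestDist_le (y : State n N) {i j : Fin N} (hj : j ≠ i) :
    nearestDist i y ≤ ‖y j - y i‖ :=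
  ciInf_le (finite_range fun j : {j // j ≠ i} => ‖y j - y i‖).bddBelow ⟨j, hj⟩

theorem nearestDist_nonneg (i : Fin N) (y : State n N) : 0 ≤ nearestDist i y :=
  Real.iInf_nonneg fun _ => norm_nonneg _

theorem nonempty_ne (hN : 1 ≤ N - 1) (i : Fin N) : Nonempty {j // j ≠ i} := by
  have : Nontrivial (Fin N) := Fin.nontrivial_iff_two_le.2 (by omega)
  exact (exists_ne i).elim fun j hj => ⟨⟨j, hj⟩⟩

theorem lipschitzWith_nearestDist (hN : 1 ≤ N - 1) (i : Fin N) :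
    LipschitzWith 2 (nearestDist (n := n) i) := by
  have := nonempty_ne hN i
  refine .of_le_add_mul _ fun y z => ?_
  obtain ⟨j, hj⟩ := exists_eq_ciInf_of_finite (f := fun j : {j // j ≠ i} => ‖z j - z i‖)
  have h1 := nearestDist_le y j.2
  have h2 := norm_sub_norm_le (y j - y i) (z j - z i)
  rw [sub_sub_sub_comm] at h2
  have h3 := norm_sub_le (y j - z j) (y i - z i)
  have h4 := dist_le_pi_dist y z j
  have h5 := dist_le_pi_dist y z i
  rw [dist_eq_norm] at h4 h5
  rw [nearestDist, nearestDist, ← hj, NNReal.coe_ofNat]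
  rw [nearestDist] at h1
  linarith

/-- `ν` picks for each agent the nearest other agent, of lowest index in case of ties. -/
structure IsNearestChoice (y : State n N) (ν : Fin N → Fin N) : Prop where
  ne : ∀ i, ν i ≠ i
  nearestDist_eq : ∀ i, nearestDist i y = ‖y (ν i) - y i‖
  le_of_eq : ∀ i j, j ≠ i → ‖y j - y i‖ = nearestDist i y → ν i ≤ j
  topologicalNeighbors_eq : ∀ i, topologicalNeighbors 1 y i = {ν i}

theorem exists_isNearestChoice (hN : 1 ≤ N - 1) (y : State n N) : ∃ ν, IsNearestChoice y ν := by
  classical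
  have hmin (i : Fin N) : ∃ j ≠ i, ∀ k ≠ i,
      toLex (‖y j - y i‖, j) ≤ toLex (‖y k - y i‖, k) := by
    obtain ⟨j, hj, hle⟩ := Finset.exists_min_image (Finset.univ.filter (· ≠ i))
      (fun k => toLex (‖y k - y i‖, k))
      ((nonempty_ne hN i).elim fun j => ⟨j, by simp [j.2]⟩)
    exact ⟨j, by simpa using hj, fun k hk => hle k (by simpa using hk)⟩
  choose ν hne hν using hmin
  have hle (i k : Fin N) (hk : k ≠ i) : ‖y (ν i) - y i‖ ≤ ‖y k - y i‖ := by
    rcases Prod.Lex.toLex_le_toLex.1 (hν i k hk) with h | h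
    exacts [h.le, h.1.le]
  have hdist (i : Fin N) : nearestDist i y = ‖y (ν i) - y i‖ :=
    have := nonempty_ne hN i
    le_antisymm (nearestDist_le y (hne i)) (le_ciInf fun k => hle i k k.2)
  refine ⟨ν, hne, hdist, fun i j hj heq => ?_, fun i => ?_⟩
  · rcases Prod.Lex.toLex_le_toLex.1 (hν i j hj) with h | h
    · rw [heq, hdist] at h
      exact absurd h (lt_irrefl _)
    · exact h.2
  · have hprec (j k : Fin N) :
        Precedes y i k j ↔ toLex (‖y k - y i‖, k) < toLex (‖y j - y i‖, j) :=
      (Prod.Lex.toLex_lt_toLex (x := (‖y k - y i‖, k)) (y := (‖y j - y i‖, j))).symm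
    ext j
    simp only [topologicalNeighbors, Finset.mem_filter, Finset.mem_univ, true_and,
      Finset.mem_singleton, Nat.lt_one_iff, Finset.card_eq_zero, Finset.filter_eq_empty_iff,
      not_and, hprec, not_lt, forall_const]
    constructor
    · rintro ⟨hj, h⟩
      have := (h (x := ν i) (hne i)).antisymm (hν i j hj)
      exact congrArg (fun p => (ofLex p).2) this
    · rintro rfl
      exact ⟨hne i, fun k hk => hν i k hk⟩

variable {y : State n N} {ν : Fin N → Fin N}

theorem IsNearestChoice.topologicalField_apply (h : IsNearestChoice y ν) (i : Fin N) :
    topologicalField 1 a y i = (a ‖y (ν i) - y i‖₊ : ℝ) • (y (ν i) - y i) := by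
  rw [topologicalField, opinionField, h.topologicalNeighbors_eq, Finset.sum_singleton]

/-- The speed of an agent at distance `r` from its only neighbor. -/
noncomputable def speed (a : ℝ≥0 → ℝ≥0) (r : ℝ) : ℝ := a r.toNNReal * r

theorem speed_norm (v : EuclideanSpace ℝ (Fin n)) : speed a ‖v‖ = a ‖v‖₊ * ‖v‖ := by
  rw [speed, norm_toNNReal]

theorem monotone_speed_of_nonneg (ha : IsInteractionFunction a) {r s : ℝ} (hr : 0 ≤ r)
    (hrs : r ≤ s) : speed a r ≤ speed a s :=
  mul_le_mul (NNReal.coe_le_coe.2 (ha.monotone (Real.toNNReal_le_toNNReal hrs))) hrs hr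
    (NNReal.coe_nonneg _)

theorem speed_nonneg {r : ℝ} (hr : 0 ≤ r) : 0 ≤ speed a r :=
  mul_nonneg (NNReal.coe_nonneg _) hr

theorem speed_pos (ha : IsInteractionFunction a) {r : ℝ} (hr : 0 < r) : 0 < speed a r :=
  mul_pos (NNReal.coe_pos.2 (ha.pos _ (Real.toNNReal_pos.2 hr))) hr

theorem IsNearestChoice.norm_topologicalField (h : IsNearestChoice y ν) (i : Fin N) :
    ‖topologicalField 1 a y i‖ = speed a (nearestDist i y) := by
  rw [h.topologicalField_apply, norm_smul, h.nearestDist_eq, speed_norm]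
  simp

theorem IsNearestChoice.nearestDist_le_of_choice (h : IsNearestChoice y ν) (i : Fin N) :
    nearestDist (ν i) y ≤ nearestDist i y := by
  rw [h.nearestDist_eq i, norm_sub_rev]
  exact nearestDist_le y (h.ne i).symm

/-- Two agents with the same distance to their nearest neighbors, the second being the choice of
the first: the first is then also nearest to the second. -/
theorem IsNearestChoice.choice_choice_le (h : IsNearestChoice y ν) {i : Fin N}
    (heq : nearestDist (ν i) y = nearestDist i y) : ν (ν i) ≤ i :=
  h.le_of_eq _ _ (h.ne i).symm (by rw [heq, h.nearestDist_eq i, norm_sub_rev])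

/-- The nearest distance of agent `i` shrinks at least at the speed of `i`, up to the speed of the
neighbor that `i` follows, and the latter does not count if the two agents follow each other. -/
theorem IsNearestChoice.deriv_nearestDist_le {x : ℝ → State n N} {t : ℝ}
    (h : IsNearestChoice (x t) ν) (hx : HasDerivAt x (topologicalField 1 a (x t)) t) {i : Fin N}
    {c : ℝ} (hc : HasDerivAt (fun s => nearestDist i (x s)) c t) :
    c ≤ -speed a (nearestDist i (x t)) + speed a (nearestDist (ν i) (x t)) ∧
      (ν (ν i) = i → c ≤ -speed a (nearestDist i (x t))) := by
  have hr := h.nearestDist_eq i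
  rcases (nearestDist_nonneg i (x t)).eq_or_lt with h0 | h0
  · have hc0 : c = 0 := hc.eq_of_le_of_eq (hasDerivAt_const t 0)
      (fun s => nearestDist_nonneg i (x s)) h0.symm
    rw [hc0, ← h0]
    have : speed a 0 = 0 := mul_zero _
    rw [this]
    simpa using speed_nonneg (nearestDist_nonneg (ν i) (x t))
  · set w := x t (ν i) - x t i with hw
    have hw0 : 0 < ‖w‖ := hr ▸ h0
    have hd : HasDerivAt (fun s => ‖x s (ν i) - x s i‖)
        (inner ℝ w (topologicalField 1 a (x t) (ν i) - topologicalField 1 a (x t) i) / ‖w‖) t := by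
      have hdiff := (hasDerivAt_pi.1 hx (ν i)).fun_sub (hasDerivAt_pi.1 hx i)
      have := hdiff.norm_sq.sqrt (by simpa using norm_ne_zero_iff.1 hw0.ne')
      simp only [Real.sqrt_sq (norm_nonneg _)] at this
      rwa [mul_div_mul_left _ _ two_ne_zero] at this
    have hcd := hd.eq_of_le_of_eq hc (fun s => nearestDist_le (x s) (h.ne i)) hr.symm
    rw [inner_sub_right, sub_div] at hcd
    have hi : inner ℝ w (topologicalField 1 a (x t) i) / ‖w‖ = speed a (nearestDist i (x t)) := by
      rw [h.topologicalField_apply, ← hw, inner_smul_right, real_inner_self_eq_norm_sq, hr,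
        speed_norm]
      field_simp
    rw [← hcd, hi]
    refine ⟨?_, fun hmut => ?_⟩
    · have : inner ℝ w (topologicalField 1 a (x t) (ν i)) / ‖w‖ ≤
          speed a (nearestDist (ν i) (x t)) := by
        rw [div_le_iff₀ hw0, ← h.norm_topologicalField, mul_comm]
        exact real_inner_le_norm _ _
      linarith
    · have : inner ℝ w (topologicalField 1 a (x t) (ν i)) / ‖w‖ ≤ 0 := by
        refine div_nonpos_of_nonpos_of_nonneg ?_ hw0.le
        rw [h.topologicalField_apply, hmut, ← neg_sub, ← hw, inner_smul_right, inner_neg_right,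
          real_inner_self_eq_norm_sq]
        exact mul_nonpos_of_nonneg_of_nonpos (NNReal.coe_nonneg _) (by simp)
      linarith

end NearestNeighbor

/-! ### Convergence in the topological model with one neighbor -/

section OneNeighbor

/-- In a class of agents with equal distances `d`, either some agent follows an agent outside of
the class, with a smaller `d`, or two agents of the class follow each other: the agent of lowest
index among those that are followed is one of them. As the rates `c` are constant on the class,
each agent of the class decreases its `d` up to the gain of an agent with smaller `d`; summing
from the smallest `d` upwards, the gains telescope. -/
theorem sum_rate_le_neg {ι : Type*} [Fintype ι] [LinearOrder ι] {d φ c : ι → ℝ} {ν : ι → ι}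
    (hd : ∀ i, d (ν i) ≤ d i) (hν : ∀ i, d (ν i) = d i → ν (ν i) ≤ i)
    (hφ : ∀ i j, d i ≤ d j → φ i ≤ φ j)
    (hc : ∀ i, c i ≤ -φ i + φ (ν i)) (hc' : ∀ i, ν (ν i) = i → c i ≤ -φ i)
    (htie : ∀ i j, d i = d j → c i = c j) (i : ι) : ∑ j, c j ≤ -φ i := by
  have hstep (i : ι) : c i ≤ -φ i ∨ ∃ j, d j < d i ∧ c i ≤ -φ i + φ j := by
    by_cases hout : ∃ k, d k = d i ∧ d (ν k) < d i
    · obtain ⟨k, hk, hνk⟩ := hout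
      refine Or.inr ⟨ν k, hνk, ?_⟩
      rw [htie i k hk.symm, (hφ i k hk.ge).antisymm (hφ k i hk.le)]
      exact hc k
    · push Not at hout
      have hstay (k) (hk : d k = d i) : d (ν k) = d i := ((hd k).trans_eq hk).antisymm (hout k hk)
      obtain ⟨k, hk, hmin⟩ := Finset.exists_min_image (Finset.univ.filter fun k => d k = d i) ν
        ⟨i, by simp⟩
      simp only [Finset.mem_filter, Finset.mem_univ, true_and] at hk hmin
      have hm := hstay k hk
      have hn := hstay _ hm
      have hmut : ν (ν (ν k)) = ν k :=
        (hν (ν k) (hn.trans hm.symm)).antisymm (hmin _ hn)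
      left
      rw [htie i (ν k) hm.symm, (hφ i _ hm.ge).antisymm (hφ _ i hm.le)]
      exact hc' _ hmut
  have hcneg (i : ι) : c i ≤ 0 := by
    linarith [hc i, hφ _ _ (hd i)]
  have hwf : WellFounded fun i j => d i < d j :=
    have : IsTrans ι fun i j => d i < d j := ⟨fun _ _ _ => lt_trans⟩
    have : Std.Irrefl fun i j : ι => d i < d j := ⟨fun _ => lt_irrefl _⟩
    Finite.wellFounded_of_trans_of_irrefl _
  have hb (j : ι) : 0 ≤ -c j := neg_nonneg.2 (hcneg j)
  have hsum (i : ι) : φ i ≤ ∑ j with d j ≤ d i, -c j := by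
    induction i using hwf.induction with
    | _ i ih =>
      rcases hstep i with h | ⟨k, hk, h⟩
      · have := Finset.single_le_sum (f := fun j => -c j)
          (s := Finset.univ.filter fun j => d j ≤ d i) (fun j _ => hb j) (a := i) (by simp)
        linarith
      · have hi : i ∉ Finset.univ.filter fun j => d j ≤ d k := by simpa using hk
        have hsub : insert i (Finset.univ.filter fun j => d j ≤ d k) ⊆
            Finset.univ.filter fun j => d j ≤ d i := by
          intro j hj
          rcases Finset.mem_insert.1 hj with rfl | hj
          · simp
          · simp only [Finset.mem_filter, Finset.mem_univ, true_and] at hj ⊢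
            exact hj.trans hk.le
        have := Finset.sum_le_sum_of_subset_of_nonneg (f := fun j => -c j) hsub fun j _ _ => hb j
        rw [Finset.sum_insert hi] at this
        linarith [ih k hk]
  have := Finset.sum_le_sum_of_subset_of_nonneg (f := fun j => -c j)
    (Finset.filter_subset (fun j => d j ≤ d i) Finset.univ) fun j _ _ => hb j
  have h2 := hsum i
  simp only [Finset.sum_neg_distrib] at this h2
  linarith

variable {n N : ℕ} {a : ℝ≥0 → ℝ≥0} {x : ℝ → State n N}

/-- The sum of the nearest distances. -/
noncomputable def totalDist (y : State n N) : ℝ := ∑ i, nearestDist i y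

theorem totalDist_nonneg (y : State n N) : 0 ≤ totalDist y :=
  Finset.sum_nonneg fun i _ => nearestDist_nonneg i y

theorem locallyLipschitz_totalDist (hN : 1 ≤ N - 1) :
    LocallyLipschitz (totalDist (n := n) (N := N)) := by
  refine (LipschitzWith.of_dist_le_mul (K := 2 * N) fun y z => ?_).locallyLipschitz
  rw [totalDist, totalDist]
  refine (dist_sum_sum_le_of_le _ fun i _ => (lipschitzWith_nearestDist hN i).dist_le_mul y z).trans
    (le_of_eq ?_)
  simp
  ring

theorem SolvesInclusionOn.ae_deriv_totalDist_le (hN : 1 ≤ N - 1) (ha : IsInteractionFunction a)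
    {s t : ℝ} (h : SolvesInclusionOn (fun y => {topologicalField 1 a y}) s t x) (hst : s ≤ t) :
    ∀ᵐ τ, τ ∈ Icc s t → ∀ c, HasDerivAt (fun r => totalDist (x r)) c τ →
      ∀ i, c ≤ -speed a (nearestDist i (x τ)) := by
  have hac (i : Fin N) := (lipschitzWith_nearestDist (n := n) hN
    i).locallyLipschitz.comp_absolutelyContinuousOnInterval h.1
  have habs (i j : Fin N) : AbsolutelyContinuousOnInterval
      (fun r => |nearestDist i (x r) - nearestDist j (x r)|) s t :=
    lipschitzWith_one_norm.locallyLipschitz.comp_absolutelyContinuousOnInterval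
      ((hac i).fun_sub (hac j))
  have hd := ae_all_iff.2 fun i => (hac i).ae_differentiableAt
  have hdabs := ae_all_iff.2 fun i => ae_all_iff.2 fun j => (habs i j).ae_differentiableAt
  rw [uIcc_of_le hst] at hd hdabs
  filter_upwards [h.2, hd, hdabs] with τ hτ hdτ hdabsτ hmem c hc i
  obtain ⟨_, rfl, hx⟩ := hτ hmem
  obtain ⟨ν, hν⟩ := exists_isNearestChoice hN (x τ)
  have hderiv (i : Fin N) := (hdτ i hmem).hasDerivAt
  have hcsum := hc.unique (HasDerivAt.fun_sum fun i _ => hderiv i)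
  rw [hcsum]
  exact sum_rate_le_neg (d := fun i => nearestDist i (x τ)) hν.nearestDist_le_of_choice
    (fun i => hν.choice_choice_le)
    (fun i j => monotone_speed_of_nonneg ha (nearestDist_nonneg i _))
    (fun i => (hν.deriv_nearestDist_le hx (hderiv i)).1)
    (fun i => (hν.deriv_nearestDist_le hx (hderiv i)).2)
    (fun i j => (hderiv i).eq_of_differentiableAt_abs_sub (hderiv j) (hdabsτ i j hmem)) i

/-- The sum of the nearest distances bounds the remaining lengths of the trajectories, and can only
converge if all nearest distances tend to zero. -/
theorem IsGlobalCaratheodorySolution.convergesToClusterPoint_topological (hN : 1 ≤ N - 1)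
    (ha : IsInteractionFunction a) (h : IsGlobalCaratheodorySolution (topologicalField 1 a) x) :
    ConvergesToClusterPoint (topologicalNeighbors 1) x := by
  have hL := locallyLipschitz_totalDist (n := n) hN
  have hlen (i : Fin N) {s t : ℝ} (hs : 0 ≤ s) (hst : s ≤ t) :
      ‖x t i - x s i‖ ≤ totalDist (x s) - totalDist (x t) := by
    have hsol := h.solvesInclusionOn hs hst
    let L : State n N →L[ℝ] EuclideanSpace ℝ (Fin n) := ContinuousLinearMap.proj i
    have := (L.lipschitz.locallyLipschitz.comp_absolutelyContinuousOnInterval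
      hsol.1).norm_sub_le_of_ae_norm_deriv_le
      (hL.comp_absolutelyContinuousOnInterval hsol.1).fun_neg hst (by
      filter_upwards [hsol.2, hsol.ae_deriv_totalDist_le hN ha hst] with τ hτ hdτ hmem
      obtain ⟨_, rfl, hx⟩ := hτ hmem
      refine ⟨_, L.hasFDerivAt.comp_hasDerivAt τ hx, fun c hc => ?_⟩
      obtain ⟨ν, hν⟩ := exists_isNearestChoice hN (x τ)
      have h1 := hdτ hmem (-c) (by simpa using hc.fun_neg) i
      have h2 : ‖L (topologicalField 1 a (x τ))‖ = _ := hν.norm_topologicalField i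
      rw [h2]
      linarith)
    have h3 : ‖x t i - x s i‖ ≤ -totalDist (x t) - -totalDist (x s) := this
    linarith
  have hlim (i : Fin N) : ∃ y, Tendsto (fun t => x t i) atTop (𝓝 y) :=
    exists_tendsto_of_norm_sub_le (D := fun t => totalDist (x t)) (T := 0)
      (fun _ _ => totalDist_nonneg _) fun s t hs hst => hlen i hs hst
  choose y hy using hlim
  have hxy : Tendsto x atTop (𝓝 y) := tendsto_pi_nhds.2 hy
  have hzero (i : Fin N) : nearestDist i y = 0 := by
    by_contra hne
    have hpos : 0 < nearestDist i y := lt_of_le_of_ne (nearestDist_nonneg i y) (Ne.symm hne)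
    have hφ := speed_pos ha (half_pos hpos)
    have hdi : ∀ᶠ t in atTop, nearestDist i y / 2 < nearestDist i (x t) :=
      (((lipschitzWith_nearestDist hN i).continuous.tendsto y).comp hxy).eventually_const_lt
        (half_lt_self hpos)
    obtain ⟨T, hT⟩ := eventually_atTop.1 (hdi.and (eventually_ge_atTop 0))
    have hdecr (t) (ht : T ≤ t) : totalDist (x (t + 1)) - totalDist (x t) ≤
        -speed a (nearestDist i y / 2) := by
      have hsol := h.solvesInclusionOn (hT t ht).2 (by linarith : t ≤ t + 1)
      have := (hL.comp_absolutelyContinuousOnInterval hsol.1).sub_le_mul_of_ae_deriv_le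
        (m := -speed a (nearestDist i y / 2)) (by linarith) (by
        filter_upwards [hsol.ae_deriv_totalDist_le hN ha (by linarith)] with τ hτ hmem c hc
        refine (hτ hmem c hc i).trans (neg_le_neg ?_)
        exact monotone_speed_of_nonneg ha (half_pos hpos).le (hT τ (ht.trans hmem.1)).1.le)
      linarith
    have hconv := (hL.continuous.tendsto y).comp hxy
    have hdiff : Tendsto (fun t => totalDist (x (t + 1)) - totalDist (x t)) atTop (𝓝 0) := by
      simpa using (hconv.comp (tendsto_atTop_add_const_right _ 1 tendsto_id)).sub hconv
    have := le_of_tendsto hdiff (eventually_atTop.2 ⟨T, hdecr⟩)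
    linarith
  refine ⟨y, fun i j hj => ?_, hxy⟩
  obtain ⟨ν, hν⟩ := exists_isNearestChoice hN y
  rw [hν.topologicalNeighbors_eq, Finset.mem_singleton] at hj
  have := hν.nearestDist_eq i
  rw [hzero, eq_comm, norm_eq_zero, sub_eq_zero] at this
  rw [hj, this]

end OneNeighbor

/-! ### Trajectories of the topological model without the conservation or convergence properties -/

section Counterexamples

theorem isGlobalCaratheodorySolution_const {X : Type*} [NormedAddCommGroup X] [NormedSpace ℝ X]
    {g : X → X} {y : X} (h : g y = 0) : IsGlobalCaratheodorySolution g fun _ => y :=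
  fun _ _ => ⟨ContDiffOn.absolutelyContinuousOnInterval contDiffOn_const,
    .of_forall fun t => by simpa only [h] using hasDerivAt_const t y⟩

theorem isGlobalKrasovskySolution_const {X : Type*} [NormedAddCommGroup X] [NormedSpace ℝ X]
    {g : X → X} {y : X} (h : 0 ∈ krasovsky g y) : IsGlobalKrasovskySolution g fun _ => y :=
  fun _ _ => ⟨ContDiffOn.absolutelyContinuousOnInterval contDiffOn_const,
    .of_forall fun t => ⟨0, h, hasDerivAt_const t y⟩⟩

theorem isInteractionFunction_one : IsInteractionFunction 1 :=
  ⟨⟨0, LipschitzWith.const (1 : ℝ≥0)⟩, fun _ _ => one_pos, fun _ _ _ => le_rfl⟩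

/-- An agent that coincides with `κ` other agents does not move. -/
theorem topologicalField_apply_eq_zero {n N κ : ℕ} {a : ℝ≥0 → ℝ≥0} {y : State n N} {i : Fin N}
    (S : Finset (Fin N)) (hS : κ ≤ S.card) (h : ∀ k ∈ S, k ≠ i ∧ y k = y i) :
    topologicalField κ a y i = 0 := by
  classical
  rw [topologicalField, opinionField]
  refine Finset.sum_eq_zero fun j hj => ?_
  have hij : y j = y i := by
    by_contra hne
    have hlt := (Finset.mem_filter.1 hj).2.2
    refine (hlt.trans_le hS).not_ge (Finset.card_le_card fun k hk => ?_)
    refine Finset.mem_filter.2 ⟨Finset.mem_univ _, (h k hk).1, Or.inl ?_⟩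
    rw [(h k hk).2, sub_self, norm_zero]
    exact norm_pos_iff.2 (sub_ne_zero.2 hne)
  rw [hij, sub_self, smul_zero]

/-- The state of agents on the real line with the given positions. -/
noncomputable def lineState {N : ℕ} (s : Fin N → ℝ) : State 1 N :=
  fun i => s i • EuclideanSpace.single 0 1

theorem norm_lineState_sub {N : ℕ} (s : Fin N → ℝ) (i j : Fin N) :
    ‖lineState s j - lineState s i‖ = |s j - s i| := by
  rw [lineState, lineState, ← sub_smul, norm_smul, PiLp.norm_single]
  simp

theorem lineState_apply_eq_iff {N : ℕ} {s : Fin N → ℝ} {i j : Fin N} :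
    lineState s i = lineState s j ↔ s i = s j := by
  rw [← sub_eq_zero, ← norm_eq_zero, norm_lineState_sub, abs_eq_zero, sub_eq_zero]

/-- Two agents rest at the origin, and a third one approaches them. -/
theorem isGlobalCaratheodorySolution_follower :
    IsGlobalCaratheodorySolution (topologicalField 1 1)
      fun t => lineState ![0, 0, Real.exp (-t)] := by
  have hder (t : ℝ) : HasDerivAt (fun t => lineState ![0, 0, Real.exp (-t)])
      (lineState ![0, 0, -Real.exp (-t)]) t := by
    refine hasDerivAt_pi.2 fun i => ?_
    refine HasDerivAt.smul_const ?_ _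
    fin_cases i
    · simpa using hasDerivAt_const t (0 : ℝ)
    · simpa using hasDerivAt_const t (0 : ℝ)
    · simpa using (hasDerivAt_neg t).exp
  have hfield (t : ℝ) : topologicalField 1 1 (lineState ![0, 0, Real.exp (-t)]) =
      lineState ![0, 0, -Real.exp (-t)] := by
    ext1 i
    have h0 : lineState ![0, 0, -Real.exp (-t)] 0 = 0 := by simp [lineState]
    have h1 : lineState ![0, 0, -Real.exp (-t)] 1 = 0 := by simp [lineState]
    obtain ⟨ν, hν⟩ := exists_isNearestChoice (by simp) (lineState ![0, 0, Real.exp (-t)])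
    fin_cases i
    · exact (topologicalField_apply_eq_zero {1} (by simp) (by simp [lineState])).trans h0.symm
    · exact (topologicalField_apply_eq_zero {0} (by simp) (by simp [lineState])).trans h1.symm
    · have hne := hν.ne 2
      have hν0 : lineState ![0, 0, Real.exp (-t)] (ν 2) = 0 := by
        generalize ν 2 = k at hne
        fin_cases k <;> simp_all [lineState]
      change topologicalField 1 1 _ 2 = _
      rw [hν.topologicalField_apply, hν0]
      simp [lineState]
  intro T _
  refine ⟨ContDiffOn.absolutelyContinuousOnInterval ?_, .of_forall fun t => ?_⟩
  · refine contDiffOn_pi.2 fun i => ?_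
    have hi : ContDiff ℝ 1 fun t : ℝ => ![0, 0, Real.exp (-t)] i := by
      fin_cases i
      exacts [contDiff_const, contDiff_const, Real.contDiff_exp.comp contDiff_neg]
    exact (hi.smul contDiff_const).contDiffOn
  · rw [hfield]
    exact hder t

theorem not_preservesAverage_follower :
    ¬PreservesAverage (Ici 0) fun t => lineState ![0, 0, Real.exp (-t)] := by
  intro h
  have h1 := congrArg (fun v => v 0) (h 1 (by simp))
  simp [_root_.average, lineState, Fin.sum_univ_three] at h1

theorem not_convergesToClusterPoint_const {n N : ℕ} {nbr : State n N → Fin N → Finset (Fin N)}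
    {y : State n N} (h : ¬IsClusterPoint nbr y) : ¬ConvergesToClusterPoint nbr fun _ => y := by
  rintro ⟨z, hz, hlim⟩
  rw [tendsto_const_nhds_iff] at hlim
  exact h (hlim ▸ hz)

/-- Two pairs of agents on both sides of a fifth agent at position `r`. -/
noncomputable def middleState (r : ℝ) : State 1 5 := lineState ![-1, -1, 1, 1, r]

theorem topologicalField_middleState {σ ρ : ℝ} (hσ : σ = 1 ∨ σ = -1) (hρ0 : 0 < ρ) (hρ : ρ < 1) :
    topologicalField 1 1 (middleState (σ * ρ)) = (σ * (1 - ρ)) • lineState ![0, 0, 0, 0, 1] := by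
  ext1 i
  rw [Pi.smul_apply]
  have hrest (k : Fin 5) (hk : ∃ j ≠ k, middleState (σ * ρ) j = middleState (σ * ρ) k) :
      topologicalField 1 1 (middleState (σ * ρ)) k = 0 := by
    obtain ⟨j, hj, hjk⟩ := hk
    exact topologicalField_apply_eq_zero {j} (by simp) (by simp [hj, hjk])
  fin_cases i
  · exact (hrest 0 ⟨1, by simp, by simp [middleState, lineState]⟩).trans (by simp [lineState])
  · exact (hrest 1 ⟨0, by simp, by simp [middleState, lineState]⟩).trans (by simp [lineState])
  · exact (hrest 2 ⟨3, by simp, by simp [middleState, lineState]⟩).trans (by simp [lineState])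
  · exact (hrest 3 ⟨2, by simp, by simp [middleState, lineState]⟩).trans (by simp [lineState])
  · obtain ⟨ν, hν⟩ := exists_isNearestChoice (by simp) (middleState (σ * ρ))
    have hne := hν.ne 4
    have h0 := (hν.nearestDist_eq 4).symm.trans_le (nearestDist_le _ (j := 0) (by simp))
    have h2 := (hν.nearestDist_eq 4).symm.trans_le (nearestDist_le _ (j := 2) (by simp))
    rw [middleState, norm_lineState_sub, norm_lineState_sub] at h0 h2
    have hpos : ![-1, -1, 1, 1, σ * ρ] (ν 4) = σ := by
      generalize ν 4 = k at h0 h2 hne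
      rcases hσ with rfl | rfl
      · fin_cases k <;> simp at h0 h2 hne ⊢ <;> grind
      · fin_cases k <;> simp at h0 h2 hne ⊢ <;> grind
    change topologicalField 1 1 _ 4 = _
    rw [hν.topologicalField_apply]
    simp only [middleState, lineState, ← sub_smul, hpos]
    simp [mul_sub]

theorem continuous_middleState : Continuous middleState := by
  refine continuous_pi fun i => ?_
  have hi : Continuous fun r : ℝ => ![-1, -1, 1, 1, r] i := by
    fin_cases i
    exacts [continuous_const, continuous_const, continuous_const, continuous_const, continuous_id]
  exact hi.smul continuous_const

/-- Displacing the fifth agent to either side yields opposite velocities. -/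
theorem zero_mem_krasovsky_middleState :
    0 ∈ krasovsky (topologicalField 1 1) (middleState 0) := by
  refine mem_iInter₂.2 fun δ hδ => subset_closure ?_
  have hnear (σ : ℝ) : ∀ᶠ ρ in 𝓝[>] (0 : ℝ), middleState (σ * ρ) ∈ Metric.ball (middleState 0) δ :=
    ((continuous_middleState.comp (continuous_const_mul σ)).tendsto' 0 (middleState 0)
      (by simp)).mono_left nhdsWithin_le_nhds |>.eventually_mem (Metric.ball_mem_nhds _ hδ)
  obtain ⟨ρ, ⟨hp, hm⟩, hρ0, hρ⟩ := (((hnear 1).and (hnear (-1))).and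
    (Ioo_mem_nhdsGT (zero_lt_one (α := ℝ)))).exists
  have := convex_convexHull ℝ _ (subset_convexHull ℝ _ (mem_image_of_mem _ hp))
    (subset_convexHull ℝ _ (mem_image_of_mem (topologicalField 1 1) hm))
    (a := 1 / 2) (b := 1 / 2) (by norm_num) (by norm_num) (by norm_num)
  rw [topologicalField_middleState (Or.inl rfl) hρ0 hρ,
    topologicalField_middleState (Or.inr rfl) hρ0 hρ] at this
  convert this using 1
  module

theorem not_isClusterPoint_middleState :
    ¬IsClusterPoint (topologicalNeighbors 1) (middleState 0) := by
  intro h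
  obtain ⟨ν, hν⟩ := exists_isNearestChoice (by simp) (middleState 0)
  have h1 := lineState_apply_eq_iff.1 (h 4 (ν 4) (by rw [hν.topologicalNeighbors_eq]; simp))
  have hne := hν.ne 4
  generalize ν 4 = k at h1 hne
  fin_cases k <;> simp_all

/-- Two triples of agents on both sides of a seventh agent. The indices are such that, all
distances being equal, the neighbors of the latter are one agent from each side. -/
noncomputable def balancedState : State 1 7 := lineState ![-1, 1, -1, -1, 1, 1, 0]

theorem topologicalNeighbors_balancedState :
    topologicalNeighbors 2 balancedState 6 = {0, 1} := by
  classical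
  have hdist (j : Fin 7) (hj : j ≠ 6) : ‖balancedState j - balancedState 6‖ = 1 := by
    rw [balancedState, norm_lineState_sub]
    fin_cases j <;> simp_all
  have hprec (j : Fin 7) (hj : j ≠ 6) :
      (Finset.univ.filter fun k => k ≠ 6 ∧ Precedes balancedState 6 k j) =
        Finset.univ.filter fun k => k ≠ 6 ∧ k < j := by
    ext k
    simp only [Finset.mem_filter, Finset.mem_univ, true_and]
    refine and_congr_right fun hk => ?_
    simp [Precedes, hdist j hj, hdist k hk]
  ext j
  simp only [topologicalNeighbors, Finset.mem_filter, Finset.mem_univ, true_and]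
  have : (j ≠ 6 ∧ (Finset.univ.filter fun k => k ≠ 6 ∧ Precedes balancedState 6 k j).card < 2) ↔
      (j ≠ 6 ∧ (Finset.univ.filter fun k => k ≠ 6 ∧ k < j).card < 2) :=
    and_congr_right fun hj => by rw [hprec j hj]
  rw [this]
  clear this hprec hdist
  revert j
  decide

theorem topologicalField_balancedState : topologicalField 2 1 balancedState = 0 := by
  ext1 i
  fin_cases i
  · exact topologicalField_apply_eq_zero {2, 3} (by simp) (by simp [balancedState, lineState])
  · exact topologicalField_apply_eq_zero {4, 5} (by simp) (by simp [balancedState, lineState])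
  · exact topologicalField_apply_eq_zero {0, 3} (by simp) (by simp [balancedState, lineState])
  · exact topologicalField_apply_eq_zero {0, 2} (by simp) (by simp [balancedState, lineState])
  · exact topologicalField_apply_eq_zero {1, 5} (by simp) (by simp [balancedState, lineState])
  · exact topologicalField_apply_eq_zero {1, 4} (by simp) (by simp [balancedState, lineState])
  · change topologicalField 2 1 balancedState 6 = 0
    rw [topologicalField, opinionField, topologicalNeighbors_balancedState,
      Finset.sum_pair (by decide)]
    simp [balancedState, lineState]

theorem not_isClusterPoint_balancedState :
    ¬IsClusterPoint (topologicalNeighbors 2) balancedState := by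
  intro h
  have := lineState_apply_eq_iff.1 (h 6 0 (by simp [topologicalNeighbors_balancedState]))
  simp at this

end Counterexamples

/-! ### Conservation, contraction and convergence for both kinds of solutions -/

theorem IsGlobalCaratheodorySolution.isGlobalKrasovskySolution {X : Type*} [NormedAddCommGroup X]
    [NormedSpace ℝ X] {g : X → X} {x : ℝ → X} (h : IsGlobalCaratheodorySolution g x) :
    IsGlobalKrasovskySolution g x :=
  fun T hT => (h T hT).isKrasovskySolution

theorem IsKrasovskySolution.contractsSupport {n N : ℕ} {a : ℝ≥0 → ℝ≥0}
    {nbr : State n N → Fin N → Finset (Fin N)} (ha : IsInteractionFunction a) {T : ℝ}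
    {x : ℝ → State n N} (h : IsKrasovskySolution (opinionField a nbr) T x) :
    ContractsSupport (Icc 0 T) x :=
  fun _ hs _ ht hst => (h.solvesInclusionOn.mono hs.1 hst ht.2).closedHull_subset ha hst

theorem IsGlobalKrasovskySolution.contractsSupport {n N : ℕ} {a : ℝ≥0 → ℝ≥0}
    {nbr : State n N → Fin N → Finset (Fin N)} (ha : IsInteractionFunction a)
    {x : ℝ → State n N} (h : IsGlobalKrasovskySolution (opinionField a nbr) x) :
    ContractsSupport (Ici 0) x :=
  fun _ hs _ _ hst => (h.solvesInclusionOn hs hst).closedHull_subset ha hst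

theorem theorem2 :
    -- (i) metric model: P1 and P2 on every time interval, P3 for solutions defined for all times
    (∀ (n N : ℕ) (a : ℝ≥0 → ℝ≥0), IsInteractionFunction a →
      (∀ T : ℝ, 0 < T → ∀ x : ℝ → State n N,
        (IsCaratheodorySolution (metricField a) T x ∨ IsKrasovskySolution (metricField a) T x) →
          PreservesAverage (Icc 0 T) x ∧ ContractsSupport (Icc 0 T) x) ∧
      (∀ x : ℝ → State n N,
        (IsGlobalCaratheodorySolution (metricField a) x ∨
            IsGlobalKrasovskySolution (metricField a) x) →
          PreservesAverage (Ici 0) x ∧ ContractsSupport (Ici 0) x ∧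
            ConvergesToClusterPoint metricNeighbors x)) ∧
    -- (ii) topological model: P2 holds
    (∀ (n N κ : ℕ) (a : ℝ≥0 → ℝ≥0), 1 ≤ κ → κ ≤ N - 1 → IsInteractionFunction a →
      (∀ T : ℝ, 0 < T → ∀ x : ℝ → State n N,
        (IsCaratheodorySolution (topologicalField κ a) T x ∨
            IsKrasovskySolution (topologicalField κ a) T x) →
          ContractsSupport (Icc 0 T) x) ∧
      (∀ x : ℝ → State n N,
        (IsGlobalCaratheodorySolution (topologicalField κ a) x ∨
            IsGlobalKrasovskySolution (topologicalField κ a) x) →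
          ContractsSupport (Ici 0) x)) ∧
    -- (ii) topological model: P1 and P3 may fail, for Caratheodory solutions
    (∃ (n N κ : ℕ) (a : ℝ≥0 → ℝ≥0) (x : ℝ → State n N),
      1 ≤ κ ∧ κ ≤ N - 1 ∧ IsInteractionFunction a ∧
        IsGlobalCaratheodorySolution (topologicalField κ a) x ∧ ¬ PreservesAverage (Ici 0) x) ∧
    (∃ (n N κ : ℕ) (a : ℝ≥0 → ℝ≥0) (x : ℝ → State n N),
      1 ≤ κ ∧ κ ≤ N - 1 ∧ IsInteractionFunction a ∧
        IsGlobalCaratheodorySolution (topologicalField κ a) x ∧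
          ¬ ConvergesToClusterPoint (topologicalNeighbors κ) x) ∧
    -- (ii) topological model: P1 and P3 may fail, for Krasovsky solutions
    (∃ (n N κ : ℕ) (a : ℝ≥0 → ℝ≥0) (x : ℝ → State n N),
      1 ≤ κ ∧ κ ≤ N - 1 ∧ IsInteractionFunction a ∧
        IsGlobalKrasovskySolution (topologicalField κ a) x ∧ ¬ PreservesAverage (Ici 0) x) ∧
    (∃ (n N κ : ℕ) (a : ℝ≥0 → ℝ≥0) (x : ℝ → State n N),
      1 ≤ κ ∧ κ ≤ N - 1 ∧ IsInteractionFunction a ∧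
        IsGlobalKrasovskySolution (topologicalField κ a) x ∧
          ¬ ConvergesToClusterPoint (topologicalNeighbors κ) x) ∧
    -- (iii) one neighbor: Caratheodory solutions satisfy P3
    (∀ (n N : ℕ) (a : ℝ≥0 → ℝ≥0), 1 ≤ N - 1 → IsInteractionFunction a →
      ∀ x : ℝ → State n N, IsGlobalCaratheodorySolution (topologicalField 1 a) x →
        ConvergesToClusterPoint (topologicalNeighbors 1) x) ∧
    -- (iii) one neighbor: P1 may still fail for Caratheodory and for Krasovsky solutions,
    -- and P3 may still fail for Krasovsky solutions
    (∃ (n N : ℕ) (a : ℝ≥0 → ℝ≥0) (x : ℝ → State n N),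
      1 ≤ N - 1 ∧ IsInteractionFunction a ∧
        IsGlobalCaratheodorySolution (topologicalField 1 a) x ∧ ¬ PreservesAverage (Ici 0) x) ∧
    (∃ (n N : ℕ) (a : ℝ≥0 → ℝ≥0) (x : ℝ → State n N),
      1 ≤ N - 1 ∧ IsInteractionFunction a ∧
        IsGlobalKrasovskySolution (topologicalField 1 a) x ∧ ¬ PreservesAverage (Ici 0) x) ∧
    (∃ (n N : ℕ) (a : ℝ≥0 → ℝ≥0) (x : ℝ → State n N),
      1 ≤ N - 1 ∧ IsInteractionFunction a ∧
        IsGlobalKrasovskySolution (topologicalField 1 a) x ∧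
          ¬ ConvergesToClusterPoint (topologicalNeighbors 1) x) := by
  have hfollow := isGlobalCaratheodorySolution_follower
  have hbalanced := isGlobalCaratheodorySolution_const topologicalField_balancedState
  have hmiddle := isGlobalKrasovskySolution_const zero_mem_krasovsky_middleState
  have hone := isInteractionFunction_one
  refine ⟨fun n N a ha => ⟨fun T hT x hx => ?_, fun x hx => ?_⟩,
    fun n N κ a _ _ ha => ⟨fun T hT x hx => ?_, fun x hx => ?_⟩,
    ⟨1, 3, 1, 1, _, le_rfl, by norm_num, hone, hfollow, not_preservesAverage_follower⟩,
    ⟨1, 7, 2, 1, _, by norm_num, by norm_num, hone, hbalanced,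
      not_convergesToClusterPoint_const not_isClusterPoint_balancedState⟩,
    ⟨1, 3, 1, 1, _, le_rfl, by norm_num, hone, hfollow.isGlobalKrasovskySolution,
      not_preservesAverage_follower⟩,
    ⟨1, 5, 1, 1, _, le_rfl, by norm_num, hone, hmiddle,
      not_convergesToClusterPoint_const not_isClusterPoint_middleState⟩,
    fun n N a hN ha x hx => hx.convergesToClusterPoint_topological hN ha,
    ⟨1, 3, 1, _, by norm_num, hone, hfollow, not_preservesAverage_follower⟩,
    ⟨1, 3, 1, _, by norm_num, hone, hfollow.isGlobalKrasovskySolution,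
      not_preservesAverage_follower⟩,
    ⟨1, 5, 1, _, by norm_num, hone, hmiddle,
      not_convergesToClusterPoint_const not_isClusterPoint_middleState⟩⟩
  · have h := hx.elim (·.isKrasovskySolution) id
    exact ⟨fun t ht => (h.solvesInclusionOn.mono le_rfl ht.1 ht.2).average_eq ht.1,
      h.contractsSupport ha⟩
  · have h := hx.elim (·.isGlobalKrasovskySolution) id
    exact ⟨fun t ht => (h.solvesInclusionOn le_rfl ht).average_eq ht, h.contractsSupport ha,
      h.convergesToClusterPoint_metric ha⟩
  · exact (hx.elim (·.isKrasovskySolution) id).contractsSupport ha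
  · exact (hx.elim (·.isGlobalKrasovskySolution) id).contractsSupport ha
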